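/- Conventions. Manifolds are smooth, finite-dimensional, Hausdorff and second countable. A Dirac structure on $M$ is a smooth subbundle $L\subset TM\oplus T^*M$ that is maximally isotropic for $\langle X+\alpha,Y+\beta\rangle_+=\tfrac12(\beta(X)+\alpha(Y))$ and whose sections are closed under the Courant bracket $$[\![X+\alpha,Y+\beta]\!]=[X,Y]+\mathcal L_X\beta-\mathcal L_Y\alpha+\tfrac12 d(\alpha(Y)-\beta(X)).$$ Its characteristic distribution is $D_L=L\cap TM$. The Dirac manifold $(M,L)$ is reducible if $D_L$ has constant rank and the leaf space $M/\mathcal F_L$ of the foliation $\mathcal F_L$ tangent to $D_L$ is a smooth manifold such that the projection $p:M\to M/\mathcal F_L$ is a submersion. A function $f\in C^\infty(M)$ is $L$-admissible if there is a smooth vector field $X_f$ with $X_f+df\in\Gamma(L)$; for admissible $f,g$ one puts $\{f,g\}_L=X_f(g)$. The reduced Poisson structure on $M/\mathcal F_L$ is the Poisson bivector $\pi$ such that for all smooth $f,g$ on $M/\mathcal F_L$ the functions $p^*f,p^*g$ are $L$-admissible and $p^*\{f,g\}_\pi=\{p^*f,p^*g\}_L$, where $\{f,g\}_\pi=dg(\pi^\sharp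 df)$. The graph of $\pi$ is $\{\pi^\sharp\alpha+\alpha\}$. A smooth map $\phi:M\to N$ is an $f$-Dirac map from $L\subset TM\oplus T^*M$ to $K\subset TN\oplus T^*N$ if for all $x\in M$ $$K_{\phi(x)}=\{\phi_*X+\alpha\in T_{\phi(x)}N\oplus T^*_{\phi(x)}N:\ X+\phi^*\alpha\in L_x\}.$$ The cotangent Lie algebroid of a Poisson manifold $(Q,\pi)$ is $T^*Q$ with anchor $\pi^\sharp$ and bracket $[\alpha,\beta]_\pi=\mathcal L_{\pi^\sharp\alpha}\beta-\mathcal L_{\pi^\sharp\beta}\alpha-d(\pi(\alpha,\beta))$. A comorphism between the cotangent Lie algebroids of $Q$ and $P$ covering a smooth map $\psi:Q\to P$ is a smooth vector bundle map $\Phi:\psi^!T^*P\to T^*Q$ such that the induced map $\bar\Phi:\Omega^1(P)\to\Omega^1(Q)$ preserves the brackets and $\psi_*\pi_Q^\sharp(\bar\Phi\alpha)=\pi_P^\sharp(\alpha)$ along $\psi$ for all $\alpha\in\Omega^1(P)$. Proposition. Let $\phi:(M,L)\to(N,K)$ be an $f$-Dirac map between reducible Dirac manifolds, with projections $p:M\to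 M/\mathcal F_L$ and $q:N\to N/\mathcal F_K$. Then: 1. $\phi$ preserves the characteristic foliations: $\phi_*(D_L)\subset D_K$, and $\phi$ maps each leaf of $\mathcal F_L$ into a leaf of $\mathcal F_K$. 2. The reduced Poisson structures $\pi_M$ on $M/\mathcal F_L$ and $\pi_N$ on $N/\mathcal F_K$ exist and are unique, and $\phi$ induces a map $\bar\phi:M/\mathcal F_L\to N/\mathcal F_K$ with $\bar\phi\circ p=q\circ\phi$, which is a (smooth) Poisson map. 3. $\bar\phi$ is an $f$-Dirac map from the graph of $\pi_M$ to the graph of $\pi_N$. 4. The bundle map $\Phi:\bar\phi^!T^*(N/\mathcal F_K)\to T^*(M/\mathcal F_L)$, $\alpha\mapsto\bar\phi^*\alpha$, is a comorphism between the cotangent Lie algebroids of the reduced Poisson manifolds, covering $\bar\phi$. -/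

import Mathlib

open Set VectorField
open scoped Manifold ContDiff

noncomputable section

namespace DiracGeometry

section Basic

/-- The cotangent space `T*_x M` of a manifold `M` modelled on `E`. -/
abbrev Cotangent (E : Type*) [NormedAddCommGroup E] [NormedSpace ℝ E]
    {M : Type*} [TopologicalSpace M] [ChartedSpace E M] (x : M) : Type _ :=
  TangentSpace 𝓘(ℝ, E) x →L[ℝ] ℝ

/-- The fibre `T_x M ⊕ T*_x M` of the generalized tangent bundle. -/
abbrev GenTangent (E : Type*) [NormedAddCommGroup E] [NormedSpace ℝ E]
    {M : Type*} [TopologicalSpace M] [ChartedSpace E M] (x : M) : Type _ :=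
  TangentSpace 𝓘(ℝ, E) x × Cotangent E x

variable {E : Type*} [NormedAddCommGroup E] [NormedSpace ℝ E]
  {M : Type*} [TopologicalSpace M] [ChartedSpace E M]

/-- Smoothness on `U` of a vector field, as a section of the tangent bundle. -/
def SmoothFieldOn [IsManifold 𝓘(ℝ, E) ∞ M] (X : Π x : M, TangentSpace 𝓘(ℝ, E) x)
    (U : Set M) : Prop :=
  ContMDiffOn 𝓘(ℝ, E) (𝓘(ℝ, E).prod 𝓘(ℝ, E)) ∞
    (fun x => Bundle.TotalSpace.mk' E (E := fun y : M => TangentSpace 𝓘(ℝ, E) y) x (X x)) U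

/-- Smoothness on `U` of a one-form, as a section of the cotangent bundle. -/
def SmoothFormOn [IsManifold 𝓘(ℝ, E) ∞ M] (α : Π x : M, Cotangent E x) (U : Set M) : Prop :=
  ContMDiffOn 𝓘(ℝ, E) (𝓘(ℝ, E).prod 𝓘(ℝ, E →L[ℝ] ℝ)) ∞
    (fun x => Bundle.TotalSpace.mk' (E →L[ℝ] ℝ) (E := fun y : M => Cotangent E y) x (α x)) U

/-- Smoothness on `U` of a section `X + α` of `TM ⊕ T*M`. -/
def SmoothGenOn [IsManifold 𝓘(ℝ, E) ∞ M] (s : Π x : M, GenTangent E x) (U : Set M) : Prop :=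
  SmoothFieldOn (fun x => (s x).1) U ∧ SmoothFormOn (fun x => (s x).2) U

/-- Smooth real functions on `M`. -/
def SmoothFun (E : Type*) [NormedAddCommGroup E] [NormedSpace ℝ E]
    {M : Type*} [TopologicalSpace M] [ChartedSpace E M] (f : M → ℝ) : Prop :=
  ContMDiff 𝓘(ℝ, E) 𝓘(ℝ, ℝ) ∞ f

/-- The symmetric pairing `⟨X + α, Y + β⟩₊ = (β(X) + α(Y)) / 2` on `T_x M ⊕ T*_x M`. -/
def pairing {x : M} (v w : GenTangent E x) : ℝ := (1 / 2) * (w.2 v.1 + v.2 w.1)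

/-- The Lie derivative `L_X β` of a one-form `β` along a vector field `X`. In a chart it is
`(L_X β)(v) = (D β · X)(v) + β(D X · v)`; at `x` the preferred chart at `x` is used. -/
def lieDerivForm (X : Π x : M, TangentSpace 𝓘(ℝ, E) x) (β : Π x : M, Cotangent E x) (x : M) :
    Cotangent E x :=
  let e := extChartAt 𝓘(ℝ, E) x
  let X' : E → E := mpullback 𝓘(ℝ, E) 𝓘(ℝ, E) e.symm X
  let β' : E → E →L[ℝ] ℝ := fun z => (β (e.symm z)).comp (mfderiv 𝓘(ℝ, E) 𝓘(ℝ, E) e.symm z)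
  (fderiv ℝ β' (e x) (X' (e x)) + (β' (e x)).comp (fderiv ℝ X' (e x))).comp
    (mfderiv 𝓘(ℝ, E) 𝓘(ℝ, E) e x)

/-- The Courant bracket
`⟦X + α, Y + β⟧ = [X, Y] + L_X β - L_Y α + d (α(Y) - β(X)) / 2`. -/
def courantBracket (s t : Π x : M, GenTangent E x) (x : M) : GenTangent E x :=
  (mlieBracket 𝓘(ℝ, E) (fun y => (s y).1) (fun y => (t y).1) x,
    lieDerivForm (fun y => (s y).1) (fun y => (t y).2) x
      - lieDerivForm (fun y => (t y).1) (fun y => (s y).2) x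
      + (1 / 2 : ℝ) •
        mvfderiv 𝓘(ℝ, E) (fun y => (s y).2 (t y).1 - (t y).2 (s y).1) x)

/-- Isotropic subspaces of `T_x M ⊕ T*_x M`. -/
def IsIsotropic {x : M} (W : Submodule ℝ (GenTangent E x)) : Prop :=
  ∀ v ∈ W, ∀ w ∈ W, pairing v w = 0

/-- A family of subspaces of the fibres of `TM ⊕ T*M` is a smooth subbundle if it has
smooth local frames. -/
def IsSmoothSubbundle [IsManifold 𝓘(ℝ, E) ∞ M] (L : Π x : M, Submodule ℝ (GenTangent E x)) :
    Prop :=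
  ∀ x : M, ∃ U : Set M, IsOpen U ∧ x ∈ U ∧
    ∃ (r : ℕ) (s : Fin r → Π y : M, GenTangent E y),
      (∀ i, SmoothGenOn (s i) U) ∧
      ∀ y ∈ U, LinearIndependent ℝ (fun i => s i y) ∧
        Submodule.span ℝ (range fun i => s i y) = L y

/-- A Dirac structure: an integrable maximally isotropic smooth subbundle of `TM ⊕ T*M`. -/
structure IsDirac [IsManifold 𝓘(ℝ, E) ∞ M] (L : Π x : M, Submodule ℝ (GenTangent E x)) :
    Prop where
  subbundle : IsSmoothSubbundle L
  maximal_isotropic : ∀ x, Maximal IsIsotropic (L x)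
  integrable : ∀ s t : Π x : M, GenTangent E x,
    SmoothGenOn s univ → SmoothGenOn t univ → (∀ x, s x ∈ L x) → (∀ x, t x ∈ L x) →
      ∀ x, courantBracket s t x ∈ L x

/-- The characteristic distribution `D_L = L ∩ TM`. -/
def charDist (L : Π x : M, Submodule ℝ (GenTangent E x)) (x : M) :
    Submodule ℝ (TangentSpace 𝓘(ℝ, E) x) :=
  (L x).comap (LinearMap.inl ℝ (TangentSpace 𝓘(ℝ, E) x) (Cotangent E x))

/-- `x` and `y` are joined by a smooth curve that is everywhere tangent to `D_L`. -/
def JoinedAlong (L : Π x : M, Submodule ℝ (GenTangent E x)) (x y : M) : Prop :=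
  ∃ γ : ℝ → M, ContMDiff 𝓘(ℝ, ℝ) 𝓘(ℝ, E) ∞ γ ∧
    (∀ t : ℝ, mfderiv 𝓘(ℝ, ℝ) 𝓘(ℝ, E) γ t (1 : ℝ) ∈ charDist L (γ t)) ∧ γ 0 = x ∧ γ 1 = y

/-- The equivalence relation whose classes are the leaves of the characteristic foliation
(for a regular distribution `D_L`): the one generated by `JoinedAlong L`. -/
def leafSetoid (L : Π x : M, Submodule ℝ (GenTangent E x)) : Setoid M :=
  Relation.EqvGen.setoid (JoinedAlong L)

/-- The leaf space `M / F_L`, which carries the quotient topology. -/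
def LeafSpace (L : Π x : M, Submodule ℝ (GenTangent E x)) : Type _ := Quotient (leafSetoid L)

instance (L : Π x : M, Submodule ℝ (GenTangent E x)) : TopologicalSpace (LeafSpace L) :=
  inferInstanceAs (TopologicalSpace (Quotient (leafSetoid L)))

/-- The projection `p : M → M / F_L`. -/
def leafProj (L : Π x : M, Submodule ℝ (GenTangent E x)) (x : M) : LeafSpace L :=
  Quotient.mk (leafSetoid L) x

/-- `(M, L)` is a reducible Dirac manifold, where `M / F_L` carries the given smooth manifold
structure modelled on `E'`: the characteristic distribution has constant rank and the projection
`M → M / F_L` is a submersion. (There is at most one smooth structure with this property.) -/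
structure IsReducibleDirac {E' : Type*} [NormedAddCommGroup E'] [NormedSpace ℝ E']
    [IsManifold 𝓘(ℝ, E) ∞ M] (L : Π x : M, Submodule ℝ (GenTangent E x))
    [ChartedSpace E' (LeafSpace L)] [IsManifold 𝓘(ℝ, E') ∞ (LeafSpace L)] : Prop where
  dirac : IsDirac L
  regular : ∃ r : ℕ, ∀ x : M, Module.finrank ℝ (charDist L x) = r
  submersion : Manifold.IsSubmersion 𝓘(ℝ, E) 𝓘(ℝ, E') ∞ (leafProj L)

/-- `X` is a Hamiltonian vector field of `f`: `X` is smooth and `X + df` is a section of `L`. -/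
def IsHamiltonianField [IsManifold 𝓘(ℝ, E) ∞ M] (L : Π x : M, Submodule ℝ (GenTangent E x))
    (f : M → ℝ) (X : Π x : M, TangentSpace 𝓘(ℝ, E) x) : Prop :=
  SmoothFieldOn X univ ∧ ∀ x, (X x, mvfderiv 𝓘(ℝ, E) f x) ∈ L x

/-- `L`-admissible functions. -/
def IsAdmissible [IsManifold 𝓘(ℝ, E) ∞ M] (L : Π x : M, Submodule ℝ (GenTangent E x))
    (f : M → ℝ) : Prop :=
  SmoothFun E f ∧ ∃ X, IsHamiltonianField L f X

/-- A bivector field on `M`, given by the maps `π^♯ : T*_x M → T_x M`. -/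
abbrev BivectorField (E : Type*) [NormedAddCommGroup E] [NormedSpace ℝ E]
    (M : Type*) [TopologicalSpace M] [ChartedSpace E M] : Type _ :=
  Π x : M, Cotangent E x →L[ℝ] TangentSpace 𝓘(ℝ, E) x

/-- The bracket `{f, g} = π(df, dg) = dg(π^♯ df)` of a bivector field. -/
def poissonBracket (π : BivectorField E M) (f g : M → ℝ) (x : M) : ℝ :=
  mvfderiv 𝓘(ℝ, E) g x (π x (mvfderiv 𝓘(ℝ, E) f x))

/-- Poisson bivector fields: smooth, skew-symmetric, and with the Jacobi identity. -/
structure IsPoisson [IsManifold 𝓘(ℝ, E) ∞ M] (π : BivectorField E M) : Prop where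
  smooth : ContMDiff 𝓘(ℝ, E) (𝓘(ℝ, E).prod 𝓘(ℝ, (E →L[ℝ] ℝ) →L[ℝ] E)) ∞
    (fun x => Bundle.TotalSpace.mk' ((E →L[ℝ] ℝ) →L[ℝ] E)
      (E := fun y : M => Cotangent E y →L[ℝ] TangentSpace 𝓘(ℝ, E) y) x (π x))
  skew : ∀ (x : M) (α β : Cotangent E x), β (π x α) = - α (π x β)
  jacobi : ∀ f g h : M → ℝ, SmoothFun E f → SmoothFun E g → SmoothFun E h → ∀ x,
    poissonBracket π f (poissonBracket π g h) x
      + poissonBracket π g (poissonBracket π h f) x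
      + poissonBracket π h (poissonBracket π f g) x = 0

/-- `π` is the reduced Poisson structure of the reducible Dirac manifold `(M, L)`: it is the
Poisson structure on `M / F_L` such that `p^*f` is `L`-admissible and
`p^*{f, g} = {p^*f, p^*g}_L = X_{p^*f}(p^*g)` for all smooth `f`, `g` on `M / F_L`. -/
structure IsReducedPoisson {E' : Type*} [NormedAddCommGroup E'] [NormedSpace ℝ E']
    [IsManifold 𝓘(ℝ, E) ∞ M] (L : Π x : M, Submodule ℝ (GenTangent E x))
    [ChartedSpace E' (LeafSpace L)] [IsManifold 𝓘(ℝ, E') ∞ (LeafSpace L)]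
    (π : BivectorField E' (LeafSpace L)) : Prop where
  poisson : IsPoisson π
  admissible : ∀ f : LeafSpace L → ℝ, SmoothFun E' f → IsAdmissible L (f ∘ leafProj L)
  bracket : ∀ f g : LeafSpace L → ℝ, SmoothFun E' f → SmoothFun E' g →
    ∀ X, IsHamiltonianField L (f ∘ leafProj L) X →
      ∀ x, poissonBracket π f g (leafProj L x) = mvfderiv 𝓘(ℝ, E) (g ∘ leafProj L) x (X x)

/-- The graph `{π^♯ α + α}` of a bivector field. -/
def graph (π : BivectorField E M) (x : M) : Submodule ℝ (GenTangent E x) :=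
  LinearMap.range ((π x : Cotangent E x →ₗ[ℝ] TangentSpace 𝓘(ℝ, E) x).prod LinearMap.id)

/-- The bracket `[α, β]_π = L_{π^♯ α} β - L_{π^♯ β} α - d (π(α, β))` of the cotangent Lie
algebroid of a Poisson manifold; its anchor is `π^♯`. -/
def cotangentBracket (π : BivectorField E M) (α β : Π x : M, Cotangent E x) (x : M) :
    Cotangent E x :=
  lieDerivForm (fun y => π y (α y)) β x - lieDerivForm (fun y => π y (β y)) α x
    - mvfderiv 𝓘(ℝ, E) (fun y => β y (π y (α y))) x

end Basic

section Maps

variable {E : Type*} [NormedAddCommGroup E] [NormedSpace ℝ E]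
  {M : Type*} [TopologicalSpace M] [ChartedSpace E M]
  {F : Type*} [NormedAddCommGroup F] [NormedSpace ℝ F]
  {N : Type*} [TopologicalSpace N] [ChartedSpace F N]

/-- Pullback of covectors `T*_{φ x} N → T*_x M`, `α ↦ φ^*α = α ∘ dφ_x`. -/
def pullbackCovector (E F : Type*) [NormedAddCommGroup E] [NormedSpace ℝ E]
    [NormedAddCommGroup F] [NormedSpace ℝ F]
    {M : Type*} [TopologicalSpace M] [ChartedSpace E M]
    {N : Type*} [TopologicalSpace N] [ChartedSpace F N] (φ : M → N) (x : M) :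
    Cotangent F (φ x) →L[ℝ] Cotangent E x :=
  ContinuousLinearMap.precomp ℝ (mfderiv 𝓘(ℝ, E) 𝓘(ℝ, F) φ x)

/-- The forward image at `x`: `{φ_* X + α | X + φ^*α ∈ L_x}` in the fibre over `φ x`. -/
def forwardImage (φ : M → N) (L : Π x : M, Submodule ℝ (GenTangent E x)) (x : M) :
    Set (GenTangent F (φ x)) :=
  {w | ∃ (X : TangentSpace 𝓘(ℝ, E) x) (α : Cotangent F (φ x)),
    (X, pullbackCovector E F φ x α) ∈ L x ∧ w = (mfderiv 𝓘(ℝ, E) 𝓘(ℝ, F) φ x X, α)}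

/-- `φ : (M, L) → (N, K)` is an `f`-Dirac (forward Dirac) map. -/
structure IsForwardDirac (φ : M → N) (L : Π x : M, Submodule ℝ (GenTangent E x))
    (K : Π y : N, Submodule ℝ (GenTangent F y)) : Prop where
  smooth : ContMDiff 𝓘(ℝ, E) 𝓘(ℝ, F) ∞ φ
  image_eq : ∀ x : M, (K (φ x) : Set (GenTangent F (φ x))) = forwardImage φ L x

/-- Poisson maps: smooth maps with `{f ∘ φ, g ∘ φ} = {f, g} ∘ φ`. -/
structure IsPoissonMap (φ : M → N) (πM : BivectorField E M) (πN : BivectorField F N) :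
    Prop where
  smooth : ContMDiff 𝓘(ℝ, E) 𝓘(ℝ, F) ∞ φ
  bracket : ∀ f g : N → ℝ, SmoothFun F f → SmoothFun F g →
    ∀ x, poissonBracket πM (f ∘ φ) (g ∘ φ) x = poissonBracket πN f g (φ x)

/-- The vector bundle map `Φ : φ^! T*N → T*M` over `M` is a Lie algebroid comorphism between
the cotangent Lie algebroids `T*M` and `T*N` covering `φ`. Smoothness of `Φ` is expressed by its
action `α ↦ (x ↦ Φ_x α_{φ x})` on one-forms. -/
structure IsCotangentComorphism [IsManifold 𝓘(ℝ, E) ∞ M] [IsManifold 𝓘(ℝ, F) ∞ N]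
    (φ : M → N) (πM : BivectorField E M) (πN : BivectorField F N)
    (Φ : Π x : M, Cotangent F (φ x) →L[ℝ] Cotangent E x) : Prop where
  smooth_base : ContMDiff 𝓘(ℝ, E) 𝓘(ℝ, F) ∞ φ
  smooth : ∀ α : Π y : N, Cotangent F y, SmoothFormOn α univ →
    SmoothFormOn (fun x => Φ x (α (φ x))) univ
  bracket : ∀ α β : Π y : N, Cotangent F y, SmoothFormOn α univ → SmoothFormOn β univ →
    ∀ x, cotangentBracket πM (fun x => Φ x (α (φ x))) (fun x => Φ x (β (φ x))) x =
      Φ x (cotangentBracket πN α β (φ x))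
  anchor : ∀ α : Π y : N, Cotangent F y, SmoothFormOn α univ →
    ∀ x, mfderiv 𝓘(ℝ, E) 𝓘(ℝ, F) φ x (πM x (Φ x (α (φ x)))) = πN (φ x) (α (φ x))

/-- `φ` preserves the characteristic foliations: it maps leaves into leaves, and its
differential maps `D_L` into `D_K`. -/
structure PreservesFoliations (φ : M → N) (L : Π x : M, Submodule ℝ (GenTangent E x))
    (K : Π y : N, Submodule ℝ (GenTangent F y)) : Prop where
  dist : ∀ (x : M), ∀ X ∈ charDist L x, mfderiv 𝓘(ℝ, E) 𝓘(ℝ, F) φ x X ∈ charDist K (φ x)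
  leaf : ∀ x y : M, leafProj L x = leafProj L y → leafProj K (φ x) = leafProj K (φ y)

end Maps

end DiracGeometry

end

/-! Write `p` for `leafProj L` and `q` for `leafProj K`. Maximal isotropy makes `D_L` the
annihilator of the covector components of `L`. Hence when `D_L` has constant rank, a smooth one-form
`β` that kills `D_L` is locally the covector part of a smooth section of `L`
(`IsDirac.exists_local_field`). Pullbacks `p^*ξ` kill `D_L`, because `p` is constant along curves
tangent to `D_L` and every vector of `D_L` is the velocity of such a curve up to a positive factor
(`IsDirac.mfderiv_leafProj_eq_zero`). So `p^*f` has local Hamiltonian fields, and a partition of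
unity glues them, the choices at each point forming an affine space.

If `X + p^*ξ ∈ L`, then `p_* X` depends only on `ξ`, since two choices of `X` differ by an element
of `D_L`. This forces the reduced bivector at `p x` to be `ξ ↦ p_* X`, which gives uniqueness. For
existence the answer must not depend on the point of the leaf. For Hamiltonian `X`, `Y` of `p^*f`,
`p^*g`, closure under the Courant bracket gives `[X, Y] + d(X(p^*g)) ∈ L`
(`IsDirac.mlieBracket_mem`), so `d(X(p^*g))` kills `D_L` and `X(p^*g)` is constant on leaves. The
same membership yields the Jacobi identity; skewness is isotropy, and smoothness comes from local
sections of `p`. Integrability of `L` enters nowhere else.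

For the map, take `ξ` at a point of `N / F_K` and `Y + q^*ξ ∈ K`. The f-Dirac condition provides `X`
with `φ_* X = Y` and `X + φ^*q^*ξ ∈ L`, and `φ^*q^* = p^*φbar^*`. Projecting `X` and `Y` gives
`φbar_* π_M(φbar^*ξ) = π_N(ξ)` (`IsForwardDirac.mfderiv_reducedMap_apply`). This one relation gives
the Poisson property, the f-Dirac property of the graphs and, with naturality of the Lie derivative,
the comorphism property. -/

noncomputable section

namespace DiracGeometry

open scoped Topology

set_option linter.unusedSectionVars false

/-! ### Smooth splitting of linear maps with kernels of constant dimension -/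

section ConstantRank

variable {E W : Type*} [NormedAddCommGroup E] [NormedSpace ℝ E] [FiniteDimensional ℝ E]
  [NormedAddCommGroup W] [NormedSpace ℝ W] [FiniteDimensional ℝ W]

/-- A family of linear maps whose kernels have constant dimension is locally split: on a fixed
complement `T` of the kernel at `z₀`, a fixed projection of `α z` is invertible, with smooth
inverse `H z`, and has the same kernel as `α z`. -/
theorem exists_splitting_of_finrank_ker_eq {α : E → E →L[ℝ] W} {O : Set E} (hO : IsOpen O)
    {z₀ : E} (hz₀ : z₀ ∈ O) (hα : ContDiffOn ℝ ∞ α O) {r : ℕ}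
    (hr : ∀ z ∈ O, Module.finrank ℝ (LinearMap.ker (α z : E →ₗ[ℝ] W)) = r) :
    ∃ (T : Submodule ℝ E) (π : W →L[ℝ] T) (H : E → T →L[ℝ] T) (O' : Set E),
      IsOpen O' ∧ z₀ ∈ O' ∧ O' ⊆ O ∧
      ContDiffOn ℝ ∞ H O' ∧ ∀ z ∈ O', (∀ t : T, H z (π (α z t)) = t) ∧
        (∀ t : T, π (α z (H z t)) = t) ∧ ∀ x, π (α z x) = 0 → α z x = 0 := by
  obtain ⟨T, hT⟩ := Submodule.exists_isCompl (LinearMap.ker (α z₀ : E →ₗ[ℝ] W))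
  have hinj : LinearMap.ker ((α z₀ : E →ₗ[ℝ] W).comp T.subtype) = ⊥ := by
    rw [LinearMap.ker_eq_bot']
    intro t ht
    have : (t : E) ∈ LinearMap.ker (α z₀ : E →ₗ[ℝ] W) ⊓ T := ⟨ht, t.2⟩
    rw [hT.inf_eq_bot] at this
    exact Subtype.ext this
  obtain ⟨π₀, hπ₀⟩ := LinearMap.exists_leftInverse_of_injective _ hinj
  set π : W →L[ℝ] T := π₀.toContinuousLinearMap with hπ
  set G : E → T →L[ℝ] T := fun z => π.comp ((α z).comp T.subtypeL) with hG
  have hGd : ContDiffOn ℝ ∞ G O :=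
    contDiffOn_const.clm_comp (hα.clm_comp contDiffOn_const)
  have hG0 : G z₀ = 1 := by
    ext t
    exact congrArg Subtype.val (LinearMap.congr_fun hπ₀ t)
  -- `G z₀` is the identity and the units are open, so `G` stays invertible near `z₀`.
  set O' : Set E := O ∩ G ⁻¹' {g | IsUnit g} with hO'
  have hO'open : IsOpen O' := hGd.continuousOn.isOpen_inter_preimage hO
    (Units.isOpen (R := T →L[ℝ] T))
  have hHd : ContDiffOn ℝ ∞ (fun z => Ring.inverse (G z)) O' := by
    intro z hz
    obtain ⟨g, hg⟩ := hz.2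
    have h1 : ContDiffAt ℝ ∞ Ring.inverse (G z) := by
      rw [← hg]; exact contDiffAt_ringInverse ℝ (R := T →L[ℝ] T) g
    exact (h1.comp z (hGd.contDiffAt (hO.mem_nhds hz.1))).contDiffWithinAt
  refine ⟨T, π, fun z => Ring.inverse (G z), O', hO'open,
    ⟨hz₀, by simp [hG0]⟩, inter_subset_left, hHd, fun z hz => ?_⟩
  have hl : Ring.inverse (G z) * G z = 1 := Ring.inverse_mul_cancel _ hz.2
  have hr' : G z * Ring.inverse (G z) = 1 := Ring.mul_inverse_cancel _ hz.2
  have hR : ∀ t : T, π (α z (Ring.inverse (G z) t)) = t := fun t => by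
    simpa [hG] using DFunLike.congr_fun hr' t
  refine ⟨fun t => by simpa [hG] using DFunLike.congr_fun hl t, hR, fun x hx => ?_⟩
  set P : E →ₗ[ℝ] T := ((π.comp (α z) : E →L[ℝ] T) : E →ₗ[ℝ] T) with hP
  have hsurj : Function.Surjective P := fun t => ⟨Ring.inverse (G z) t, hR t⟩
  -- One inclusion is clear. `P` maps onto `T`, so its kernel has dimension `dim E - dim T = r`,
  -- which constant rank also gives for `ker (α z)`.
  have hker : LinearMap.ker (α z : E →ₗ[ℝ] W) = LinearMap.ker P := by
    refine Submodule.eq_of_le_of_finrank_eq (fun y hy => ?_) ?_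
    · have hy' : α z y = 0 := hy
      simp [hP, hy']
    · have h1 := P.finrank_range_add_finrank_ker
      rw [LinearMap.range_eq_top.2 hsurj, finrank_top] at h1
      have h2 := Submodule.finrank_add_eq_of_isCompl hT
      rw [hr z₀ hz₀] at h2
      rw [hr z hz.1]
      omega
  have : x ∈ LinearMap.ker P := hx
  rw [← hker] at this
  exact this

end ConstantRank

/-! ### Vector fields and one-forms in a chart -/

section Charts

variable {E : Type*} [NormedAddCommGroup E] [NormedSpace ℝ E]
  {M : Type*} [TopologicalSpace M] [ChartedSpace E M]

/-- The expression of a vector field in the preferred chart at `x₀`. -/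
def fieldRep (x₀ : M) (X : Π x : M, TangentSpace 𝓘(ℝ, E) x) : E → E :=
  mpullback 𝓘(ℝ, E) 𝓘(ℝ, E) (extChartAt 𝓘(ℝ, E) x₀).symm X

/-- The expression of a one-form in the preferred chart at `x₀`. -/
def formRep (x₀ : M) (α : Π x : M, Cotangent E x) : E → E →L[ℝ] ℝ := fun z =>
  (α ((extChartAt 𝓘(ℝ, E) x₀).symm z)).comp
    (mfderiv 𝓘(ℝ, E) 𝓘(ℝ, E) (extChartAt 𝓘(ℝ, E) x₀).symm z)

theorem extChartAt_target_mem (x₀ : M) :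
    (extChartAt 𝓘(ℝ, E) x₀).target ∈ 𝓝 (extChartAt 𝓘(ℝ, E) x₀ x₀) :=
  (isOpen_extChartAt_target x₀).mem_nhds (mem_extChartAt_target x₀)

variable [IsManifold 𝓘(ℝ, E) ∞ M]

theorem _root_.ContinuousLinearMap.IsInvertible.apply_inverse {V W : Type*} [AddCommGroup V]
    [Module ℝ V] [TopologicalSpace V] [AddCommGroup W] [Module ℝ W] [TopologicalSpace W]
    {f : V →L[ℝ] W} (hf : f.IsInvertible) (w : W) : f (f.inverse w) = w := by
  obtain ⟨g, rfl⟩ := hf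
  rw [ContinuousLinearMap.inverse_equiv]
  exact g.apply_symm_apply w

theorem _root_.ContinuousLinearMap.IsInvertible.inverse_apply {V W : Type*} [AddCommGroup V]
    [Module ℝ V] [TopologicalSpace V] [AddCommGroup W] [Module ℝ W] [TopologicalSpace W]
    {f : V →L[ℝ] W} (hf : f.IsInvertible) (v : V) : f.inverse (f v) = v := by
  obtain ⟨g, rfl⟩ := hf
  rw [ContinuousLinearMap.inverse_equiv]
  exact g.symm_apply_apply v

instance : IsManifold 𝓘(ℝ, E) 1 M := IsManifold.of_le (n := ∞) (by simp)

theorem mfderiv_symm_mfderiv_extChartAt {x₀ : M} {z : E} (hz : z ∈ (extChartAt 𝓘(ℝ, E) x₀).target)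
    (v : TangentSpace 𝓘(ℝ, E) ((extChartAt 𝓘(ℝ, E) x₀).symm z)) :
    mfderiv 𝓘(ℝ, E) 𝓘(ℝ, E) (extChartAt 𝓘(ℝ, E) x₀).symm z
      (mfderiv 𝓘(ℝ, E) 𝓘(ℝ, E) (extChartAt 𝓘(ℝ, E) x₀)
        ((extChartAt 𝓘(ℝ, E) x₀).symm z) v) = v := by
  have := mfderivWithin_extChartAt_symm_comp_mfderiv_extChartAt (I := 𝓘(ℝ, E)) hz
  rw [modelWithCornersSelf_coe, range_id, mfderivWithin_univ] at this
  exact DFunLike.congr_fun this v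

theorem mfderiv_extChartAt_mfderiv_symm {x₀ : M} {z : E} (hz : z ∈ (extChartAt 𝓘(ℝ, E) x₀).target)
    (v : TangentSpace 𝓘(ℝ, E) z) :
    mfderiv 𝓘(ℝ, E) 𝓘(ℝ, E) (extChartAt 𝓘(ℝ, E) x₀) ((extChartAt 𝓘(ℝ, E) x₀).symm z)
      (mfderiv 𝓘(ℝ, E) 𝓘(ℝ, E) (extChartAt 𝓘(ℝ, E) x₀).symm z v) = v := by
  have := mfderiv_extChartAt_comp_mfderivWithin_extChartAt_symm (I := 𝓘(ℝ, E)) hz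
  rw [modelWithCornersSelf_coe, range_id, mfderivWithin_univ] at this
  exact DFunLike.congr_fun this v

theorem isInvertible_mfderiv_extChartAt_symm {x₀ : M} {z : E}
    (hz : z ∈ (extChartAt 𝓘(ℝ, E) x₀).target) :
    (mfderiv 𝓘(ℝ, E) 𝓘(ℝ, E) (extChartAt 𝓘(ℝ, E) x₀).symm z).IsInvertible := by
  have := isInvertible_mfderivWithin_extChartAt_symm (I := 𝓘(ℝ, E)) hz
  rwa [modelWithCornersSelf_coe, range_id, mfderivWithin_univ] at this

theorem mfderiv_symm_fieldRep {x₀ : M} {z : E} (hz : z ∈ (extChartAt 𝓘(ℝ, E) x₀).target)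
    (X : Π x : M, TangentSpace 𝓘(ℝ, E) x) :
    mfderiv 𝓘(ℝ, E) 𝓘(ℝ, E) (extChartAt 𝓘(ℝ, E) x₀).symm z (fieldRep (E := E) x₀ X z : E) =
      X ((extChartAt 𝓘(ℝ, E) x₀).symm z) :=
  (isInvertible_mfderiv_extChartAt_symm hz).apply_inverse _

theorem fieldRep_apply {x₀ : M} {z : E} (hz : z ∈ (extChartAt 𝓘(ℝ, E) x₀).target)
    (X : Π x : M, TangentSpace 𝓘(ℝ, E) x) :
    fieldRep x₀ X z = mfderiv 𝓘(ℝ, E) 𝓘(ℝ, E) (extChartAt 𝓘(ℝ, E) x₀)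
      ((extChartAt 𝓘(ℝ, E) x₀).symm z) (X ((extChartAt 𝓘(ℝ, E) x₀).symm z)) := by
  rw [← mfderiv_symm_fieldRep hz X]
  exact (mfderiv_extChartAt_mfderiv_symm hz _).symm

theorem formRep_fieldRep {x₀ : M} {z : E} (hz : z ∈ (extChartAt 𝓘(ℝ, E) x₀).target)
    (α : Π x : M, Cotangent E x) (X : Π x : M, TangentSpace 𝓘(ℝ, E) x) :
    formRep x₀ α z (fieldRep x₀ X z) =
      α ((extChartAt 𝓘(ℝ, E) x₀).symm z) (X ((extChartAt 𝓘(ℝ, E) x₀).symm z)) :=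
  congrArg _ (mfderiv_symm_fieldRep hz X)

theorem contMDiffAt_extChartAt_symm {x₀ : M} {z : E}
    (hz : z ∈ (extChartAt 𝓘(ℝ, E) x₀).target) :
    ContMDiffAt 𝓘(ℝ, E) 𝓘(ℝ, E) ∞ (extChartAt 𝓘(ℝ, E) x₀).symm z :=
  (contMDiffOn_extChartAt_symm x₀).contMDiffAt ((isOpen_extChartAt_target x₀).mem_nhds hz)

theorem mdifferentiableAt_extChartAt_symm {x₀ : M} {z : E}
    (hz : z ∈ (extChartAt 𝓘(ℝ, E) x₀).target) :
    MDifferentiableAt 𝓘(ℝ, E) 𝓘(ℝ, E) (extChartAt 𝓘(ℝ, E) x₀).symm z :=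
  (contMDiffAt_extChartAt_symm hz).mdifferentiableAt (by simp)

/-- The vector field with a given expression in the preferred chart at `x₀`. -/
def fieldOfRep (x₀ : M) (V : E → E) : Π x : M, TangentSpace 𝓘(ℝ, E) x := fun x =>
  mfderiv 𝓘(ℝ, E) 𝓘(ℝ, E) (extChartAt 𝓘(ℝ, E) x₀).symm (extChartAt 𝓘(ℝ, E) x₀ x)
    (V (extChartAt 𝓘(ℝ, E) x₀ x))

end Charts

/-! ### Testing smoothness of bundle maps on sections -/

section HomBundle

open Bundle

/-- A map into a space of continuous linear maps on a finite-dimensional space is smooth if it is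
so after evaluation at each vector. -/
theorem contMDiffAt_clm_of_forall_apply {E : Type*} [NormedAddCommGroup E] [NormedSpace ℝ E]
    {M : Type*} [TopologicalSpace M] [ChartedSpace E M]
    {V W : Type*} [NormedAddCommGroup V] [NormedSpace ℝ V] [FiniteDimensional ℝ V]
    [NormedAddCommGroup W] [NormedSpace ℝ W] {f : M → V →L[ℝ] W} {x₀ : M}
    (h : ∀ v, ContMDiffAt 𝓘(ℝ, E) 𝓘(ℝ, W) ∞ (fun x => f x v) x₀) :
    ContMDiffAt 𝓘(ℝ, E) 𝓘(ℝ, V →L[ℝ] W) ∞ f x₀ := by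
  have e1 : V ≃L[ℝ] Fin (Module.finrank ℝ V) → ℝ := ContinuousLinearEquiv.ofFinrankEq (by simp)
  let e2 := (e1.arrowCongr (1 : W ≃L[ℝ] W)).trans (ContinuousLinearEquiv.piRing (𝕜 := ℝ) (E := W)
    (Fin (Module.finrank ℝ V)))
  have h2 : ContMDiffAt 𝓘(ℝ, E) 𝓘(ℝ, Fin (Module.finrank ℝ V) → W) ∞ (fun x => e2 (f x)) x₀ := by
    rw [contMDiffAt_pi_space]
    intro i
    exact h (e1.symm (Pi.single i 1))
  have h3 := e2.symm.contDiff.contMDiff.contMDiffAt.comp x₀ h2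
  refine h3.congr_of_eventuallyEq (Filter.Eventually.of_forall fun x => ?_)
  simp

variable {E : Type*} [NormedAddCommGroup E] [NormedSpace ℝ E]
  {M : Type*} [TopologicalSpace M] [ChartedSpace E M]
  {F₁ F₂ : Type*} {E₁ E₂ : M → Type*}
  [∀ x, AddCommGroup (E₁ x)] [∀ x, Module ℝ (E₁ x)] [NormedAddCommGroup F₁] [NormedSpace ℝ F₁]
  [TopologicalSpace (TotalSpace F₁ E₁)] [∀ x, TopologicalSpace (E₁ x)]
  [∀ x, IsTopologicalAddGroup (E₁ x)] [∀ x, ContinuousSMul ℝ (E₁ x)]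
  [∀ x, AddCommGroup (E₂ x)] [∀ x, Module ℝ (E₂ x)] [NormedAddCommGroup F₂] [NormedSpace ℝ F₂]
  [TopologicalSpace (TotalSpace F₂ E₂)] [∀ x, TopologicalSpace (E₂ x)]
  [∀ x, IsTopologicalAddGroup (E₂ x)] [∀ x, ContinuousSMul ℝ (E₂ x)]
  [FiberBundle F₁ E₁] [VectorBundle ℝ F₁ E₁] [FiberBundle F₂ E₂] [VectorBundle ℝ F₂ E₂]
  [ContMDiffVectorBundle ∞ F₁ E₁ 𝓘(ℝ, E)] [ContMDiffVectorBundle ∞ F₂ E₂ 𝓘(ℝ, E)]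

/-- The section of a vector bundle that is constant in a trivialization is smooth. -/
theorem contMDiffAt_symmL_apply {x₀ x : M} (hx : x ∈ (trivializationAt F₁ E₁ x₀).baseSet) (v : F₁) :
    ContMDiffAt 𝓘(ℝ, E) (𝓘(ℝ, E).prod 𝓘(ℝ, F₁)) ∞
      (fun y => TotalSpace.mk' F₁ y ((trivializationAt F₁ E₁ x₀).symmL ℝ y v)) x := by
  rw [(trivializationAt F₁ E₁ x₀).contMDiffAt_section_iff hx]
  refine (contMDiffAt_const (c := v)).congr_of_eventuallyEq ?_
  filter_upwards [(trivializationAt F₁ E₁ x₀).open_baseSet.mem_nhds hx] with y hy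
  rw [Trivialization.symmL_apply _ hy, Trivialization.apply_mk_symm _ hy]

/-- A section of a bundle of linear maps is smooth if it maps smooth sections to smooth sections. -/
theorem contMDiffAt_hom_of_forall [FiniteDimensional ℝ F₁] {ϕ : Π x : M, E₁ x →L[ℝ] E₂ x} {x₀ : M}
    (h : ∀ s : Π x : M, E₁ x, (∀ᶠ x in 𝓝 x₀, ContMDiffAt 𝓘(ℝ, E) (𝓘(ℝ, E).prod 𝓘(ℝ, F₁)) ∞
        (fun x => TotalSpace.mk' F₁ x (s x)) x) →
      ContMDiffAt 𝓘(ℝ, E) (𝓘(ℝ, E).prod 𝓘(ℝ, F₂)) ∞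
        (fun x => TotalSpace.mk' F₂ x (ϕ x (s x))) x₀) :
    ContMDiffAt 𝓘(ℝ, E) (𝓘(ℝ, E).prod 𝓘(ℝ, F₁ →L[ℝ] F₂)) ∞
      (fun x => TotalSpace.mk' (F₁ →L[ℝ] F₂) (E := fun x => E₁ x →L[ℝ] E₂ x) x (ϕ x)) x₀ := by
  rw [contMDiffAt_hom_bundle]
  refine ⟨contMDiffAt_id, contMDiffAt_clm_of_forall_apply fun v => ?_⟩
  -- The test sections are constant in the trivialization. They are known to be smooth only on its
  -- base set, so `h` must accept sections smooth merely near `x₀`.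
  have h1 := h (fun y => (trivializationAt F₁ E₁ x₀).symmL ℝ y v) (by
    filter_upwards [(trivializationAt F₁ E₁ x₀).open_baseSet.mem_nhds
      (mem_baseSet_trivializationAt F₁ E₁ x₀)] with y hy
    exact contMDiffAt_symmL_apply hy v)
  rw [contMDiffAt_section] at h1
  refine h1.congr_of_eventuallyEq ?_
  filter_upwards [(trivializationAt F₁ E₁ x₀).open_baseSet.mem_nhds
      (mem_baseSet_trivializationAt F₁ E₁ x₀), (trivializationAt F₂ E₂ x₀).open_baseSet.mem_nhds
      (mem_baseSet_trivializationAt F₂ E₂ x₀)] with y hy hy2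
  simp [ContinuousLinearMap.inCoordinates, Trivialization.coe_linearMapAt_of_mem _ hy2]

end HomBundle

/-! ### Smoothness at a point and in charts -/

section Forms

variable {E : Type*} [NormedAddCommGroup E] [NormedSpace ℝ E]
  {M : Type*} [TopologicalSpace M] [ChartedSpace E M] [IsManifold 𝓘(ℝ, E) ∞ M]

/-- Smoothness of a vector field at a point. -/
abbrev SmoothFieldAt (X : Π x : M, TangentSpace 𝓘(ℝ, E) x) (x₀ : M) : Prop :=
  ContMDiffAt 𝓘(ℝ, E) (𝓘(ℝ, E).prod 𝓘(ℝ, E)) ∞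
    (fun x => Bundle.TotalSpace.mk' E (E := fun y : M => TangentSpace 𝓘(ℝ, E) y) x (X x)) x₀

/-- Smoothness of a one-form at a point. -/
abbrev SmoothFormAt (α : Π x : M, Cotangent E x) (x₀ : M) : Prop :=
  ContMDiffAt 𝓘(ℝ, E) (𝓘(ℝ, E).prod 𝓘(ℝ, E →L[ℝ] ℝ)) ∞
    (fun x => Bundle.TotalSpace.mk' (E →L[ℝ] ℝ) (E := fun y : M => Cotangent E y) x (α x)) x₀

/-- Smoothness of a real function at a point, as a section of the trivial bundle. -/
theorem contMDiffAt_section_trivial {f : M → ℝ} {x₀ : M} :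
    ContMDiffAt 𝓘(ℝ, E) (𝓘(ℝ, E).prod 𝓘(ℝ, ℝ)) ∞
      (fun x => Bundle.TotalSpace.mk' ℝ (E := Bundle.Trivial M ℝ) x (f x)) x₀ ↔
    ContMDiffAt 𝓘(ℝ, E) 𝓘(ℝ, ℝ) ∞ f x₀ := by
  rw [Bundle.contMDiffAt_section]
  rfl

theorem SmoothFormAt.apply {α : Π x : M, Cotangent E x} {X : Π x : M, TangentSpace 𝓘(ℝ, E) x}
    {x₀ : M} (hα : SmoothFormAt α x₀) (hX : SmoothFieldAt X x₀) :
    ContMDiffAt 𝓘(ℝ, E) 𝓘(ℝ, ℝ) ∞ (fun x => α x (X x)) x₀ :=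
  contMDiffAt_section_trivial.1 (ContMDiffAt.clm_bundle_apply (E₂ := Bundle.Trivial M ℝ) hα hX)

theorem smoothFormAt_of_forall [FiniteDimensional ℝ E] {α : Π x : M, Cotangent E x} {x₀ : M}
    (h : ∀ X : Π x : M, TangentSpace 𝓘(ℝ, E) x, (∀ᶠ x in 𝓝 x₀, SmoothFieldAt X x) →
      ContMDiffAt 𝓘(ℝ, E) 𝓘(ℝ, ℝ) ∞ (fun x => α x (X x)) x₀) : SmoothFormAt α x₀ :=
  contMDiffAt_hom_of_forall (E₂ := Bundle.Trivial M ℝ)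
    fun X hX => contMDiffAt_section_trivial.2 (h X hX)

end Forms

section FormCharts

variable {E : Type*} [NormedAddCommGroup E] [NormedSpace ℝ E] [FiniteDimensional ℝ E]
  {M : Type*} [TopologicalSpace M] [ChartedSpace E M] [IsManifold 𝓘(ℝ, E) ∞ M]

theorem SmoothFieldOn.smoothFieldAt {X : Π x : M, TangentSpace 𝓘(ℝ, E) x} {U : Set M} {x : M}
    (hX : SmoothFieldOn X U) (hU : U ∈ 𝓝 x) : SmoothFieldAt X x :=
  ContMDiffOn.contMDiffAt hX hU

theorem SmoothFormOn.smoothFormAt {α : Π x : M, Cotangent E x} {U : Set M} {x : M}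
    (hα : SmoothFormOn α U) (hU : U ∈ 𝓝 x) : SmoothFormAt α x :=
  ContMDiffOn.contMDiffAt hα hU

theorem smoothFieldOn_of_forall {X : Π x : M, TangentSpace 𝓘(ℝ, E) x} {U : Set M}
    (h : ∀ x ∈ U, SmoothFieldAt X x) : SmoothFieldOn X U :=
  fun x hx => (h x hx).contMDiffWithinAt

theorem smoothFormOn_of_forall {α : Π x : M, Cotangent E x} {U : Set M}
    (h : ∀ x ∈ U, SmoothFormAt α x) : SmoothFormOn α U :=
  fun x hx => (h x hx).contMDiffWithinAt

theorem SmoothFieldAt.contDiffAt_fieldRep {X : Π x : M, TangentSpace 𝓘(ℝ, E) x} {x₀ : M} {z : E}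
    (hz : z ∈ (extChartAt 𝓘(ℝ, E) x₀).target)
    (hX : SmoothFieldAt X ((extChartAt 𝓘(ℝ, E) x₀).symm z)) :
    ContDiffAt ℝ ∞ (fieldRep x₀ X) z :=
  haveI : CompleteSpace E := FiniteDimensional.complete ℝ E
  contMDiffAt_vectorSpace_iff_contDiffAt.1 (hX.mpullback_vectorField_preimage
    (contMDiffAt_extChartAt_symm hz) (isInvertible_mfderiv_extChartAt_symm hz) (by simp))

theorem smoothFieldAt_fieldOfRep {x₀ x : M} {V : E → E}
    (hx : x ∈ (extChartAt 𝓘(ℝ, E) x₀).source)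
    (hV : ContDiffAt ℝ ∞ V (extChartAt 𝓘(ℝ, E) x₀ x)) : SmoothFieldAt (fieldOfRep x₀ V) x := by
  have : CompleteSpace E := FiniteDimensional.complete ℝ E
  have h2 := (contMDiffAt_vectorSpace_iff_contDiffAt.2 hV).mpullback_vectorField_preimage
    (contMDiffAt_extChartAt' (n := ∞) (I := 𝓘(ℝ, E)) (by simpa using hx))
    (isInvertible_mfderiv_extChartAt hx) (by simp)
  refine h2.congr_of_eventuallyEq ?_
  filter_upwards [(isOpen_extChartAt_source (I := 𝓘(ℝ, E)) x₀).mem_nhds hx] with y hy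
  congr 1
  have hy' := (extChartAt 𝓘(ℝ, E) x₀).map_source hy
  have hl := (extChartAt 𝓘(ℝ, E) x₀).left_inv hy
  have hinv := isInvertible_mfderiv_extChartAt (I := 𝓘(ℝ, E)) hy
  have := mfderiv_extChartAt_mfderiv_symm hy' (V (extChartAt 𝓘(ℝ, E) x₀ y))
  rw! [hl] at this
  change _ = (mfderiv 𝓘(ℝ, E) 𝓘(ℝ, E) (extChartAt 𝓘(ℝ, E) x₀) y).inverse
    (V (extChartAt 𝓘(ℝ, E) x₀ y))
  rw [← this, hinv.inverse_apply]
  rfl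

theorem fieldOfRep_symm {x₀ : M} {z : E} (hz : z ∈ (extChartAt 𝓘(ℝ, E) x₀).target) (V : E → E) :
    fieldOfRep x₀ V ((extChartAt 𝓘(ℝ, E) x₀).symm z) =
      mfderiv 𝓘(ℝ, E) 𝓘(ℝ, E) (extChartAt 𝓘(ℝ, E) x₀).symm z (V z) := by
  have h : extChartAt 𝓘(ℝ, E) x₀ ((extChartAt 𝓘(ℝ, E) x₀).symm z) = z :=
    (extChartAt 𝓘(ℝ, E) x₀).right_inv hz
  rw [fieldOfRep]
  rw! [h]
  rfl

/-- The coefficient of `α` at a fixed vector `v` is the function obtained by evaluating `α` on the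
field that is constantly `v` in the chart. -/
theorem SmoothFormAt.contDiffAt_formRep {α : Π x : M, Cotangent E x} {x₀ : M} {z : E}
    (hz : z ∈ (extChartAt 𝓘(ℝ, E) x₀).target)
    (hα : SmoothFormAt α ((extChartAt 𝓘(ℝ, E) x₀).symm z)) :
    ContDiffAt ℝ ∞ (formRep x₀ α) z := by
  rw [← contMDiffAt_iff_contDiffAt]
  refine contMDiffAt_clm_of_forall_apply fun v => ?_
  have h1 := hα.apply (smoothFieldAt_fieldOfRep (x₀ := x₀) (V := fun _ => v)
    ((extChartAt 𝓘(ℝ, E) x₀).map_target hz) contDiffAt_const)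
  refine (h1.comp z (contMDiffAt_extChartAt_symm hz)).congr_of_eventuallyEq ?_
  filter_upwards [(isOpen_extChartAt_target x₀).mem_nhds hz] with y hy
  change _ = α ((extChartAt 𝓘(ℝ, E) x₀).symm y)
    (fieldOfRep x₀ (fun _ => v) ((extChartAt 𝓘(ℝ, E) x₀).symm y))
  rw [fieldOfRep_symm hy]
  rfl

theorem formRep_mvfderiv {x₀ : M} {z : E} (hz : z ∈ (extChartAt 𝓘(ℝ, E) x₀).target) {h : M → ℝ}
    (hh : MDifferentiableAt 𝓘(ℝ, E) 𝓘(ℝ, ℝ) h ((extChartAt 𝓘(ℝ, E) x₀).symm z)) :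
    formRep x₀ (mvfderiv 𝓘(ℝ, E) h) z = fderiv ℝ (h ∘ (extChartAt 𝓘(ℝ, E) x₀).symm) z := by
  have := mvfderiv_comp z hh (mdifferentiableAt_extChartAt_symm hz)
  exact this.symm.trans mfderiv_eq_fderiv

theorem contDiffAt_comp_extChartAt_symm {x₀ : M} {z : E}
    (hz : z ∈ (extChartAt 𝓘(ℝ, E) x₀).target) {h : M → ℝ}
    (hh : ContMDiffAt 𝓘(ℝ, E) 𝓘(ℝ, ℝ) ∞ h ((extChartAt 𝓘(ℝ, E) x₀).symm z)) :
    ContDiffAt ℝ ∞ (h ∘ (extChartAt 𝓘(ℝ, E) x₀).symm) z :=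
  contMDiffAt_iff_contDiffAt.1 (hh.comp z (contMDiffAt_extChartAt_symm hz))

end FormCharts

/-! ### Differentials, pushforwards and pullbacks -/

section Push

variable {E : Type*} [NormedAddCommGroup E] [NormedSpace ℝ E] [FiniteDimensional ℝ E]
  {M : Type*} [TopologicalSpace M] [ChartedSpace E M] [IsManifold 𝓘(ℝ, E) ∞ M]
  {F : Type*} [NormedAddCommGroup F] [NormedSpace ℝ F]
  {N : Type*} [TopologicalSpace N] [ChartedSpace F N] [IsManifold 𝓘(ℝ, F) ∞ N]

/-- The differential of a smooth map applied to a smooth vector field along a map is smooth. -/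
theorem ContMDiff.contMDiffAt_mfderiv_apply {φ : M → N} (hφ : ContMDiff 𝓘(ℝ, E) 𝓘(ℝ, F) ∞ φ)
    {G : Type*} [NormedAddCommGroup G] [NormedSpace ℝ G] {Q : Type*} [TopologicalSpace Q]
    [ChartedSpace G Q] {b : Q → M} {X : Π q : Q, TangentSpace 𝓘(ℝ, E) (b q)} {q₀ : Q}
    (hX : ContMDiffAt 𝓘(ℝ, G) (𝓘(ℝ, E).prod 𝓘(ℝ, E)) ∞
      (fun q => Bundle.TotalSpace.mk' E (E := fun y : M => TangentSpace 𝓘(ℝ, E) y) (b q) (X q)) q₀) :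
    ContMDiffAt 𝓘(ℝ, G) (𝓘(ℝ, F).prod 𝓘(ℝ, F)) ∞
      (fun q => Bundle.TotalSpace.mk' F (E := fun y : N => TangentSpace 𝓘(ℝ, F) y) (φ (b q))
        (mfderiv 𝓘(ℝ, E) 𝓘(ℝ, F) φ (b q) (X q))) q₀ :=
  (ContMDiff.contMDiff_tangentMap (m := ∞) hφ (by simp)).contMDiffAt.comp q₀ hX

theorem SmoothFun.contMDiffAt_mvfderiv_apply {f : M → ℝ} (hf : SmoothFun E f)
    {X : Π x : M, TangentSpace 𝓘(ℝ, E) x} {x₀ : M} (hX : SmoothFieldAt X x₀) :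
    ContMDiffAt 𝓘(ℝ, E) 𝓘(ℝ, ℝ) ∞ (fun x => mvfderiv 𝓘(ℝ, E) f x (X x)) x₀ :=
  (contMDiff_snd_tangentBundle_modelSpace ℝ 𝓘(ℝ, ℝ)).contMDiffAt.comp x₀
    (ContMDiff.contMDiffAt_mfderiv_apply hf hX)

theorem SmoothFun.smoothFormAt_mvfderiv {f : M → ℝ} (hf : SmoothFun E f) (x₀ : M) :
    SmoothFormAt (mvfderiv 𝓘(ℝ, E) f) x₀ :=
  smoothFormAt_of_forall fun _ hX => hf.contMDiffAt_mvfderiv_apply hX.self_of_nhds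

theorem ContMDiff.smoothFormAt_pullback {φ : M → N} (hφ : ContMDiff 𝓘(ℝ, E) 𝓘(ℝ, F) ∞ φ)
    {α : Π y : N, Cotangent F y} {x₀ : M} (hα : SmoothFormAt α (φ x₀)) :
    SmoothFormAt (fun x => pullbackCovector E F φ x (α (φ x))) x₀ :=
  smoothFormAt_of_forall fun X hX => by
    have h := ContMDiffAt.clm_bundle_apply (E₂ := Bundle.Trivial N ℝ) (b := φ)
      (v := fun x => mfderiv 𝓘(ℝ, E) 𝓘(ℝ, F) φ x (X x))
      (hα.comp x₀ hφ.contMDiffAt)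
      (ContMDiff.contMDiffAt_mfderiv_apply hφ hX.self_of_nhds)
    rw [Bundle.contMDiffAt_totalSpace] at h
    exact h.2

end Push

/-! ### Lie brackets and Lie derivatives acting on functions -/

section LieDerivative

variable {E : Type*} [NormedAddCommGroup E] [NormedSpace ℝ E] [FiniteDimensional ℝ E]
  {M : Type*} [TopologicalSpace M] [ChartedSpace E M] [IsManifold 𝓘(ℝ, E) ∞ M]

theorem SmoothFieldOn.contDiffAt_fieldRep {X : Π x : M, TangentSpace 𝓘(ℝ, E) x}
    (hX : SmoothFieldOn X univ) {x₀ : M} {z : E} (hz : z ∈ (extChartAt 𝓘(ℝ, E) x₀).target) :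
    ContDiffAt ℝ ∞ (fieldRep x₀ X) z :=
  SmoothFieldAt.contDiffAt_fieldRep hz (hX.smoothFieldAt Filter.univ_mem)

theorem SmoothFormOn.contDiffAt_formRep {α : Π x : M, Cotangent E x}
    (hα : SmoothFormOn α univ) {x₀ : M} {z : E} (hz : z ∈ (extChartAt 𝓘(ℝ, E) x₀).target) :
    ContDiffAt ℝ ∞ (formRep x₀ α) z :=
  SmoothFormAt.contDiffAt_formRep hz (hα.smoothFormAt Filter.univ_mem)

theorem mvfderiv_apply_symm {x₀ : M} {z : E} (hz : z ∈ (extChartAt 𝓘(ℝ, E) x₀).target) {h : M → ℝ}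
    (hh : MDifferentiableAt 𝓘(ℝ, E) 𝓘(ℝ, ℝ) h ((extChartAt 𝓘(ℝ, E) x₀).symm z))
    (X : Π x : M, TangentSpace 𝓘(ℝ, E) x) :
    mvfderiv 𝓘(ℝ, E) h ((extChartAt 𝓘(ℝ, E) x₀).symm z) (X ((extChartAt 𝓘(ℝ, E) x₀).symm z)) =
      fderiv ℝ (h ∘ (extChartAt 𝓘(ℝ, E) x₀).symm) z (fieldRep x₀ X z) := by
  rw [← formRep_mvfderiv hz hh, formRep_fieldRep hz]

theorem mvfderiv_eq_fderiv_comp {x : M} {h : M → ℝ}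
    (hh : MDifferentiableAt 𝓘(ℝ, E) 𝓘(ℝ, ℝ) h x) (v : TangentSpace 𝓘(ℝ, E) x) :
    mvfderiv 𝓘(ℝ, E) h x v = fderiv ℝ (h ∘ (extChartAt 𝓘(ℝ, E) x).symm) (extChartAt 𝓘(ℝ, E) x x)
      (mfderiv 𝓘(ℝ, E) 𝓘(ℝ, E) (extChartAt 𝓘(ℝ, E) x) x v) := by
  have hl := extChartAt_to_inv (I := 𝓘(ℝ, E)) x
  have hz := mem_extChartAt_target (I := 𝓘(ℝ, E)) x
  have h1 := formRep_mvfderiv hz (h := h) (by rwa [hl])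
  have h2 := mfderiv_symm_mfderiv_extChartAt hz
  rw [← h1]
  rw! [hl] at h2
  change _ = (mvfderiv 𝓘(ℝ, E) h ((extChartAt 𝓘(ℝ, E) x).symm (extChartAt 𝓘(ℝ, E) x x))) _
  rw! [hl]
  exact congrArg _ (h2 v).symm

/-- The bracket is natural under pullback by the inverse chart, and on the model space it is the
usual vector space bracket. -/
theorem fieldRep_mlieBracket {X Y : Π x : M, TangentSpace 𝓘(ℝ, E) x}
    (hX : SmoothFieldOn X univ) (hY : SmoothFieldOn Y univ) {x₀ : M} {z : E}
    (hz : z ∈ (extChartAt 𝓘(ℝ, E) x₀).target) :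
    fieldRep x₀ (mlieBracket 𝓘(ℝ, E) X Y) z =
      lieBracket ℝ (fieldRep x₀ X) (fieldRep x₀ Y) z := by
  have : CompleteSpace E := FiniteDimensional.complete ℝ E
  have : IsManifold 𝓘(ℝ, E) (minSmoothness ℝ 3) M := by
    rw [minSmoothness_of_isRCLikeNormedField]
    exact IsManifold.of_le (n := ∞) ENat.LEInfty.out
  have h := mpullback_mlieBracket (I := 𝓘(ℝ, E)) (I' := 𝓘(ℝ, E)) (n := ∞)
    (f := (extChartAt 𝓘(ℝ, E) x₀).symm) (x₀ := z)
    ((hX.smoothFieldAt Filter.univ_mem).mdifferentiableAt (by simp))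
    ((hY.smoothFieldAt Filter.univ_mem).mdifferentiableAt (by simp))
    (contMDiffAt_extChartAt_symm hz)
    (by rw [minSmoothness_of_isRCLikeNormedField]; exact ENat.LEInfty.out)
  rw [← mlieBracketWithin_univ (I := 𝓘(ℝ, E)) (M := E), mlieBracketWithin_eq_lieBracketWithin] at h
  exact h.trans (congrFun lieBracketWithin_univ z)

/-- The Lie bracket acts on functions as a commutator. -/
theorem mvfderiv_mlieBracket {X Y : Π x : M, TangentSpace 𝓘(ℝ, E) x}
    (hX : SmoothFieldOn X univ) (hY : SmoothFieldOn Y univ) {h : M → ℝ} (hh : SmoothFun E h)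
    (x : M) :
    mvfderiv 𝓘(ℝ, E) h x (mlieBracket 𝓘(ℝ, E) X Y x) =
      mvfderiv 𝓘(ℝ, E) (fun y => mvfderiv 𝓘(ℝ, E) h y (Y y)) x (X x) -
        mvfderiv 𝓘(ℝ, E) (fun y => mvfderiv 𝓘(ℝ, E) h y (X y)) x (Y x) := by
  have hz := mem_extChartAt_target (I := 𝓘(ℝ, E)) x
  have key : ∀ {X : Π x : M, TangentSpace 𝓘(ℝ, E) x}, SmoothFieldOn X univ →
      ((fun y => mvfderiv 𝓘(ℝ, E) h y (X y)) ∘ (extChartAt 𝓘(ℝ, E) x).symm) =ᶠ[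
        𝓝 (extChartAt 𝓘(ℝ, E) x x)] fun z =>
        fderiv ℝ (h ∘ (extChartAt 𝓘(ℝ, E) x).symm) z (fieldRep x X z) := by
    intro X hX
    filter_upwards [extChartAt_target_mem x] with z hz
    exact mvfderiv_apply_symm hz (hh.mdifferentiableAt (by simp)) X
  have hsm : ∀ {X : Π x : M, TangentSpace 𝓘(ℝ, E) x}, SmoothFieldOn X univ → ∀ y,
      MDifferentiableAt 𝓘(ℝ, E) 𝓘(ℝ, ℝ) (fun y => mvfderiv 𝓘(ℝ, E) h y (X y)) y := fun hX y =>
    (hh.contMDiffAt_mvfderiv_apply (hX.smoothFieldAt Filter.univ_mem)).mdifferentiableAt (by simp)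
  have h1 := mvfderiv_apply_symm hz (hh.mdifferentiableAt (by simp)) (mlieBracket 𝓘(ℝ, E) X Y)
  have h2 := mvfderiv_apply_symm hz (hsm hY _) X
  have h3 := mvfderiv_apply_symm hz (hsm hX _) Y
  rw [(key hY).fderiv_eq] at h2
  rw [(key hX).fderiv_eq] at h3
  rw [fieldRep_mlieBracket hX hY hz, fderiv_apply_lieBracket (n := ∞)
    (contDiffAt_comp_extChartAt_symm hz (hh _))
    (by rw [minSmoothness_of_isRCLikeNormedField]; exact ENat.LEInfty.out)
    ((hY.contDiffAt_fieldRep hz).differentiableAt (by simp))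
    ((hX.contDiffAt_fieldRep hz).differentiableAt (by simp)), ← h2, ← h3] at h1
  rwa [extChartAt_to_inv (I := 𝓘(ℝ, E)) x] at h1

/-- `L_X dh = d(X h)`. -/
theorem lieDerivForm_mvfderiv {X : Π x : M, TangentSpace 𝓘(ℝ, E) x}
    (hX : SmoothFieldOn X univ) {h : M → ℝ} (hh : SmoothFun E h) (x : M) :
    lieDerivForm X (mvfderiv 𝓘(ℝ, E) h) x =
      mvfderiv 𝓘(ℝ, E) (fun y => mvfderiv 𝓘(ℝ, E) h y (X y)) x := by
  have hz := mem_extChartAt_target (I := 𝓘(ℝ, E)) x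
  have hl := extChartAt_to_inv (I := 𝓘(ℝ, E)) x
  have hhat := contDiffAt_comp_extChartAt_symm (h := h) hz (hh _)
  have hV := hX.contDiffAt_fieldRep hz
  have hu : ((fun y => mvfderiv 𝓘(ℝ, E) h y (X y)) ∘ (extChartAt 𝓘(ℝ, E) x).symm) =ᶠ[
        𝓝 (extChartAt 𝓘(ℝ, E) x x)] fun z =>
        fderiv ℝ (h ∘ (extChartAt 𝓘(ℝ, E) x).symm) z (fieldRep x X z) := by
    filter_upwards [extChartAt_target_mem x] with z hz
    exact mvfderiv_apply_symm hz (hh.mdifferentiableAt (by simp)) X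
  have hd : formRep x (mvfderiv 𝓘(ℝ, E) h) =ᶠ[𝓝 (extChartAt 𝓘(ℝ, E) x x)]
      fderiv ℝ (h ∘ (extChartAt 𝓘(ℝ, E) x).symm) := by
    filter_upwards [extChartAt_target_mem x] with z hz
    exact formRep_mvfderiv hz (hh.mdifferentiableAt (by simp))
  -- In the chart the two sides differ only in the order of the arguments of the second derivative
  -- of `h`.
  have hsymm := hhat.isSymmSndFDerivAt (n := ∞)
    (by rw [minSmoothness_of_isRCLikeNormedField]; exact ENat.LEInfty.out)
  have hdd : DifferentiableAt ℝ (fderiv ℝ (h ∘ (extChartAt 𝓘(ℝ, E) x).symm))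
      (extChartAt 𝓘(ℝ, E) x x) :=
    (hhat.fderiv_right (m := ∞) (by simp)).differentiableAt (by simp)
  ext v
  rw [mvfderiv_eq_fderiv_comp ((hh.contMDiffAt_mvfderiv_apply
    (hX.smoothFieldAt Filter.univ_mem)).mdifferentiableAt (by simp)), hu.fderiv_eq,
    fderiv_clm_apply hdd (hV.differentiableAt (by simp))]
  change (fderiv ℝ (formRep x (mvfderiv 𝓘(ℝ, E) h)) (extChartAt 𝓘(ℝ, E) x x)
    (fieldRep x X (extChartAt 𝓘(ℝ, E) x x)) + (formRep x (mvfderiv 𝓘(ℝ, E) h)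
      (extChartAt 𝓘(ℝ, E) x x)).comp (fderiv ℝ (fieldRep x X) (extChartAt 𝓘(ℝ, E) x x)))
    (mfderiv 𝓘(ℝ, E) 𝓘(ℝ, E) (extChartAt 𝓘(ℝ, E) x) x v) = _
  rw [hd.fderiv_eq, hd.self_of_nhds]
  generalize (mfderiv 𝓘(ℝ, E) 𝓘(ℝ, E) (extChartAt 𝓘(ℝ, E) x) x v : E) = w
  refine (add_comm _ _).trans ?_
  exact congrArg₂ (· + ·) rfl (hsymm _ _)

end LieDerivative

/-! ### Naturality of the Lie derivative of one-forms -/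

section Naturality

/-- Naturality of the Lie derivative of one-forms under a map between vector spaces. -/
theorem fderiv_pullback_apply_add {E F : Type*} [NormedAddCommGroup E] [NormedSpace ℝ E]
    [NormedAddCommGroup F] [NormedSpace ℝ F] {f : E → F} {V : E → E} {V' : F → F}
    {a : E → E →L[ℝ] ℝ} {b : F → F →L[ℝ] ℝ} {z : E} (hf : ContDiffAt ℝ ∞ f z)
    (hV : DifferentiableAt ℝ V z) (hV' : DifferentiableAt ℝ V' (f z))
    (hb : DifferentiableAt ℝ b (f z)) (hVV' : ∀ᶠ y in 𝓝 z, V' (f y) = fderiv ℝ f y (V y))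
    (hab : ∀ᶠ y in 𝓝 z, a y = (b (f y)).comp (fderiv ℝ f y)) (w : E) :
    fderiv ℝ a z (V z) w + a z (fderiv ℝ V z w) =
      fderiv ℝ b (f z) (V' (f z)) (fderiv ℝ f z w) +
        b (f z) (fderiv ℝ V' (f z) (fderiv ℝ f z w)) := by
  have hdf : HasFDerivAt f (fderiv ℝ f z) z := (hf.differentiableAt (by simp)).hasFDerivAt
  have hddf : HasFDerivAt (fderiv ℝ f) (fderiv ℝ (fderiv ℝ f) z) z :=
    ((hf.fderiv_right (m := ∞) (by simp)).differentiableAt (by simp)).hasFDerivAt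
  have hsymm := hf.isSymmSndFDerivAt (n := ∞)
    (by rw [minSmoothness_of_isRCLikeNormedField]; exact ENat.LEInfty.out)
  have h1 : fderiv ℝ a z = _ := (((hb.hasFDerivAt.comp z hdf).clm_comp hddf).congr_of_eventuallyEq hab).fderiv
  -- Differentiating `V' ∘ f = df · V` along `w` gives `DV'(df w) = D²f(w, V) + df(DV w)`.
  -- Differentiating `a` along `V` produces the term `b(D²f(V, w))`, and the two second derivatives
  -- cancel by symmetry.
  have h2 := (hV'.hasFDerivAt.comp z hdf).unique
    ((hddf.clm_apply hV.hasFDerivAt).congr_of_eventuallyEq hVV')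
  have h3 := DFunLike.congr_fun h2 w
  simp only [ContinuousLinearMap.comp_apply, add_apply,
    ContinuousLinearMap.flip_apply] at h3
  rw [h1, hab.self_of_nhds, h3, hVV'.self_of_nhds]
  simp only [add_apply, ContinuousLinearMap.comp_apply, map_add,
    ContinuousLinearMap.compL_apply, ContinuousLinearMap.flip_apply, Function.comp_apply]
  rw [hsymm (V z) w]
  ring

variable {E : Type*} [NormedAddCommGroup E] [NormedSpace ℝ E] [FiniteDimensional ℝ E]
  {M : Type*} [TopologicalSpace M] [ChartedSpace E M] [IsManifold 𝓘(ℝ, E) ∞ M]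
  {F : Type*} [NormedAddCommGroup F] [NormedSpace ℝ F] [FiniteDimensional ℝ F]
  {N : Type*} [TopologicalSpace N] [ChartedSpace F N] [IsManifold 𝓘(ℝ, F) ∞ N]

theorem fderiv_extChartAt_comp_apply {φ : M → N} (hφ : ContMDiff 𝓘(ℝ, E) 𝓘(ℝ, F) ∞ φ) {x₀ : M}
    {y₀ : N} {z : E} (hz : z ∈ (extChartAt 𝓘(ℝ, E) x₀).target)
    (hy : φ ((extChartAt 𝓘(ℝ, E) x₀).symm z) ∈ (extChartAt 𝓘(ℝ, F) y₀).source) (w : E) :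
    fderiv ℝ (extChartAt 𝓘(ℝ, F) y₀ ∘ φ ∘ (extChartAt 𝓘(ℝ, E) x₀).symm) z w =
      mfderiv 𝓘(ℝ, F) 𝓘(ℝ, F) (extChartAt 𝓘(ℝ, F) y₀) (φ ((extChartAt 𝓘(ℝ, E) x₀).symm z))
        (mfderiv 𝓘(ℝ, E) 𝓘(ℝ, F) φ ((extChartAt 𝓘(ℝ, E) x₀).symm z)
          (mfderiv 𝓘(ℝ, E) 𝓘(ℝ, E) (extChartAt 𝓘(ℝ, E) x₀).symm z w)) := by
  rw [← mfderiv_eq_fderiv]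
  have h1 : MDifferentiableAt 𝓘(ℝ, F) 𝓘(ℝ, F) (extChartAt 𝓘(ℝ, F) y₀)
      (φ ((extChartAt 𝓘(ℝ, E) x₀).symm z)) :=
    mdifferentiableAt_extChartAt (by simpa using hy)
  have h2 := hφ.mdifferentiableAt (x := (extChartAt 𝓘(ℝ, E) x₀).symm z) (by simp)
  have h3 := mdifferentiableAt_extChartAt_symm hz
  have h4 := mfderiv_comp z h1 (h2.comp z h3)
  have h5 := mfderiv_comp z h2 h3
  rw [h5] at h4
  exact DFunLike.congr_fun h4 w

/-- Naturality of the Lie derivative of one-forms along related vector fields. -/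
theorem lieDerivForm_pullback {φ : M → N} (hφ : ContMDiff 𝓘(ℝ, E) 𝓘(ℝ, F) ∞ φ)
    {X : Π x : M, TangentSpace 𝓘(ℝ, E) x} {X' : Π y : N, TangentSpace 𝓘(ℝ, F) y}
    (hX : SmoothFieldOn X univ) (hX' : SmoothFieldOn X' univ)
    (hXX' : ∀ x, mfderiv 𝓘(ℝ, E) 𝓘(ℝ, F) φ x (X x) = X' (φ x))
    {β : Π y : N, Cotangent F y} (hβ : SmoothFormOn β univ) (x : M) :
    lieDerivForm X (fun x => pullbackCovector E F φ x (β (φ x))) x =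
      pullbackCovector E F φ x (lieDerivForm X' β (φ x)) := by
  set f : E → F := extChartAt 𝓘(ℝ, F) (φ x) ∘ φ ∘ (extChartAt 𝓘(ℝ, E) x).symm with hfdef
  have hz := mem_extChartAt_target (I := 𝓘(ℝ, E)) x
  have hl := extChartAt_to_inv (I := 𝓘(ℝ, E)) x
  have hfz : f (extChartAt 𝓘(ℝ, E) x x) = extChartAt 𝓘(ℝ, F) (φ x) (φ x) := by simp [hfdef]
  have hz' := mem_extChartAt_target (I := 𝓘(ℝ, F)) (φ x)
  have hcs : ContMDiffAt 𝓘(ℝ, E) 𝓘(ℝ, F) ∞ (φ ∘ (extChartAt 𝓘(ℝ, E) x).symm)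
      (extChartAt 𝓘(ℝ, E) x x) := hφ.contMDiffAt.comp _ (contMDiffAt_extChartAt_symm hz)
  have hO : ∀ᶠ z in 𝓝 (extChartAt 𝓘(ℝ, E) x x), z ∈ (extChartAt 𝓘(ℝ, E) x).target ∧
      φ ((extChartAt 𝓘(ℝ, E) x).symm z) ∈ (extChartAt 𝓘(ℝ, F) (φ x)).source := by
    refine Filter.Eventually.and (extChartAt_target_mem x) (hcs.continuousAt.eventually_mem ?_)
    rw [Function.comp_apply, hl]
    exact extChartAt_source_mem_nhds _
  have hf : ContDiffAt ℝ ∞ f (extChartAt 𝓘(ℝ, E) x x) := by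
    rw [← contMDiffAt_iff_contDiffAt]
    refine ContMDiffAt.comp _ ?_ hcs
    rw [Function.comp_apply, hl]
    exact contMDiffAt_extChartAt
  have hVV' : ∀ᶠ z in 𝓝 (extChartAt 𝓘(ℝ, E) x x),
      fieldRep (φ x) X' (f z) = fderiv ℝ f z (fieldRep x X z) := by
    filter_upwards [hO] with z ⟨hz, hy⟩
    rw [fderiv_extChartAt_comp_apply hφ hz hy]
    have h1 := fieldRep_apply ((extChartAt 𝓘(ℝ, F) (φ x)).map_source hy) X'
    have h2 := (extChartAt 𝓘(ℝ, F) (φ x)).left_inv hy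
    rw! [h2] at h1
    refine h1.trans (congrArg _ ?_)
    rw [← hXX']
    exact congrArg _ (mfderiv_symm_fieldRep hz X).symm
  have hab : ∀ᶠ z in 𝓝 (extChartAt 𝓘(ℝ, E) x x),
      formRep x (fun x => pullbackCovector E F φ x (β (φ x))) z =
        (formRep (φ x) β (f z)).comp (fderiv ℝ f z) := by
    filter_upwards [hO] with z ⟨hz, hy⟩
    ext w
    rw [ContinuousLinearMap.comp_apply, fderiv_extChartAt_comp_apply hφ hz hy]
    have h2 := (extChartAt 𝓘(ℝ, F) (φ x)).left_inv hy
    have h3 := mfderiv_symm_mfderiv_extChartAt ((extChartAt 𝓘(ℝ, F) (φ x)).map_source hy)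
    rw! [h2] at h3
    change _ = β ((extChartAt 𝓘(ℝ, F) (φ x)).symm (extChartAt 𝓘(ℝ, F) (φ x)
      (φ ((extChartAt 𝓘(ℝ, E) x).symm z)))) _
    rw! [h2]
    exact congrArg _ (h3 _).symm
  ext v
  have key := fderiv_pullback_apply_add hf ((hX.contDiffAt_fieldRep hz).differentiableAt (by simp))
    (by rw [hfz]; exact (hX'.contDiffAt_fieldRep hz').differentiableAt (by simp))
    (by rw [hfz]; exact (hβ.contDiffAt_formRep hz').differentiableAt (by simp))
    hVV' hab (mfderiv 𝓘(ℝ, E) 𝓘(ℝ, E) (extChartAt 𝓘(ℝ, E) x) x v)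
  refine Eq.trans (Eq.trans rfl key) ?_
  have h6 : fderiv ℝ f (extChartAt 𝓘(ℝ, E) x x)
      (mfderiv 𝓘(ℝ, E) 𝓘(ℝ, E) (extChartAt 𝓘(ℝ, E) x) x v) =
      mfderiv 𝓘(ℝ, F) 𝓘(ℝ, F) (extChartAt 𝓘(ℝ, F) (φ x)) (φ x)
        (mfderiv 𝓘(ℝ, E) 𝓘(ℝ, F) φ x v) := by
    have h7 := fderiv_extChartAt_comp_apply hφ hz hO.self_of_nhds.2
    have h8 := mfderiv_symm_mfderiv_extChartAt hz
    rw! [hl] at h7 h8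
    exact (h7 _).trans (congrArg _ (congrArg _ (h8 v)))
  rw [h6, hfz]
  rfl

end Naturality

/-! ### Linear algebra of maximal isotropic subspaces -/

section Pointwise

variable {E : Type*} [NormedAddCommGroup E] [NormedSpace ℝ E]
  {M : Type*} [TopologicalSpace M] [ChartedSpace E M]

/-- A maximal isotropic subspace contains every isotropic vector orthogonal to it. -/
theorem mem_of_maximal_isIsotropic {x : M} {W : Submodule ℝ (GenTangent E x)}
    (hW : Maximal IsIsotropic W) {v : GenTangent E x} (hv : v.2 v.1 = 0)
    (h : ∀ w ∈ W, w.2 v.1 + v.2 w.1 = 0) : v ∈ W := by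
  refine hW.le_of_ge (y := W ⊔ Submodule.span ℝ {v}) ?_ le_sup_left
    (Submodule.mem_sup_right (Submodule.mem_span_singleton_self v))
  intro a ha b hb
  obtain ⟨a, ha', c, hc, rfl⟩ := Submodule.mem_sup.1 ha
  obtain ⟨b, hb', d, hd, rfl⟩ := Submodule.mem_sup.1 hb
  obtain ⟨c, rfl⟩ := Submodule.mem_span_singleton.1 hc
  obtain ⟨d, rfl⟩ := Submodule.mem_span_singleton.1 hd
  have h1 := hW.prop a ha' b hb'
  have h2 := h a ha'
  have h3 := h b hb'
  simp only [pairing, Prod.fst_add, Prod.snd_add, Prod.smul_fst, Prod.smul_snd, map_add,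
    add_apply, smul_apply, map_smul, smul_eq_mul] at h1 ⊢
  linear_combination h1 + (1 / 2) * d * h2 + (1 / 2) * c * h3 + c * d * hv

theorem IsDirac.pairing_eq_zero [IsManifold 𝓘(ℝ, E) ∞ M]
    {L : Π x : M, Submodule ℝ (GenTangent E x)} (hL : IsDirac L) {x : M} {v w : GenTangent E x}
    (hv : v ∈ L x) (hw : w ∈ L x) : w.2 v.1 + v.2 w.1 = 0 := by
  have := (hL.maximal_isotropic x).prop v hv w hw
  rw [pairing] at this
  linarith

/-- The characteristic distribution is the annihilator of the projection of `L` to `T*M`. -/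
theorem IsDirac.mem_charDist_iff [IsManifold 𝓘(ℝ, E) ∞ M]
    {L : Π x : M, Submodule ℝ (GenTangent E x)} (hL : IsDirac L) {x : M}
    {X : TangentSpace 𝓘(ℝ, E) x} : X ∈ charDist L x ↔ ∀ w ∈ L x, w.2 X = 0 := by
  refine ⟨fun hX w hw => ?_, fun h => ?_⟩
  · simpa using hL.pairing_eq_zero hX hw
  -- The vector `X + 0` is isotropic, and `h` says that it is orthogonal to `L x`.
  · exact mem_of_maximal_isIsotropic (v := (X, (0 : Cotangent E x)))
      (hL.maximal_isotropic x) (by simp) (by simpa using h)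

end Pointwise

/-! ### Local sections of `D_L` and of `L` -/

section LocalFrames

variable {E : Type*} [NormedAddCommGroup E] [NormedSpace ℝ E] [FiniteDimensional ℝ E]
  {M : Type*} [TopologicalSpace M] [ChartedSpace E M] [IsManifold 𝓘(ℝ, E) ∞ M]

theorem eventually_extChartAt_symm {x₀ : M} {Q : M → Prop} (h : ∀ᶠ y in 𝓝 x₀, Q y) :
    ∀ᶠ z in 𝓝 (extChartAt 𝓘(ℝ, E) x₀ x₀), Q ((extChartAt 𝓘(ℝ, E) x₀).symm z) := by
  have := continuousAt_extChartAt_symm (I := 𝓘(ℝ, E)) x₀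
  rw [ContinuousAt, extChartAt_to_inv] at this
  exact this.eventually h

theorem eventually_of_extChartAt_symm {x₀ : M} {Q : M → Prop}
    (h : ∀ᶠ z in 𝓝 (extChartAt 𝓘(ℝ, E) x₀ x₀), Q ((extChartAt 𝓘(ℝ, E) x₀).symm z)) :
    ∀ᶠ y in 𝓝 x₀, Q y := by
  filter_upwards [(continuousAt_extChartAt (I := 𝓘(ℝ, E)) x₀).eventually h,
    extChartAt_source_mem_nhds (I := 𝓘(ℝ, E)) x₀] with y hy hys
  rwa [(extChartAt 𝓘(ℝ, E) x₀).left_inv hys] at hy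

/-- The one-form components of a family of sections of `TM ⊕ T*M`, in the chart at `x₀`. -/
def formFrame (x₀ : M) {k : ℕ} (s : Fin k → Π y : M, GenTangent E y) (z : E) :
    E →L[ℝ] (Fin k → ℝ) :=
  ContinuousLinearMap.pi fun i => formRep x₀ (fun y => (s i y).2) z

/-- A Dirac structure with regular characteristic distribution has local frames in which the
characteristic distribution is split off smoothly. -/
theorem IsDirac.exists_local_splitting {L : Π x : M, Submodule ℝ (GenTangent E x)}
    (hL : IsDirac L) (hr : ∃ r : ℕ, ∀ x : M, Module.finrank ℝ (charDist L x) = r) (x₀ : M) :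
    ∃ (k : ℕ) (s : Fin k → Π y : M, GenTangent E y) (T : Submodule ℝ E)
      (π : (Fin k → ℝ) →L[ℝ] T) (H : E → T →L[ℝ] T),
      (∀ᶠ y in 𝓝 x₀, ∀ i, SmoothFieldAt (fun y => (s i y).1) y ∧ s i y ∈ L y) ∧
      ∀ᶠ z in 𝓝 (extChartAt 𝓘(ℝ, E) x₀ x₀), z ∈ (extChartAt 𝓘(ℝ, E) x₀).target ∧
        ContDiffAt ℝ ∞ (formFrame x₀ s) z ∧ ContDiffAt ℝ ∞ H z ∧
        (∀ t : T, H z (π (formFrame x₀ s z t)) = t) ∧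
        (∀ t : T, π (formFrame x₀ s z (H z t)) = t) ∧
        (∀ v, π (formFrame x₀ s z v) = 0 → formFrame x₀ s z v = 0) ∧
        ∀ v, formFrame x₀ s z v = 0 ↔
          mfderiv 𝓘(ℝ, E) 𝓘(ℝ, E) (extChartAt 𝓘(ℝ, E) x₀).symm z v ∈
            charDist L ((extChartAt 𝓘(ℝ, E) x₀).symm z) := by
  obtain ⟨U, hU, hx₀, k, s, hs, hspan⟩ := hL.subbundle x₀
  obtain ⟨r, hr⟩ := hr
  set e := extChartAt 𝓘(ℝ, E) x₀ with he
  set O : Set E := e.target ∩ e.symm ⁻¹' U with hOdef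
  have hO : IsOpen O :=
    (continuousOn_extChartAt_symm x₀).isOpen_inter_preimage (isOpen_extChartAt_target x₀) hU
  have hz₀ : e x₀ ∈ O := ⟨mem_extChartAt_target x₀, by
    rw [mem_preimage, he, extChartAt_to_inv]; exact hx₀⟩
  have hform : ∀ z ∈ O, ContDiffAt ℝ ∞ (formFrame x₀ s) z := fun z hz => by
    have h1 : ContDiffAt ℝ ∞ (fun z i => formRep x₀ (fun y => (s i y).2) z) z :=
      contDiffAt_pi.2 fun i => SmoothFormAt.contDiffAt_formRep hz.1
        ((hs i).2.smoothFormAt (hU.mem_nhds hz.2))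
    exact (ContinuousLinearMap.contDiff
      (ContinuousLinearMap.piEquivL ℝ E (fun _ : Fin k => ℝ) :
        (Fin k → E →L[ℝ] ℝ) →L[ℝ] (E →L[ℝ] (Fin k → ℝ)))).contDiffAt.comp z h1
  have hker : ∀ z ∈ O, ∀ v, formFrame x₀ s z v = 0 ↔
      mfderiv 𝓘(ℝ, E) 𝓘(ℝ, E) e.symm z v ∈ charDist L (e.symm z) := by
    intro z hz v
    rw [hL.mem_charDist_iff, ← (hspan _ hz.2).2]
    refine ⟨fun h w hw => ?_, fun h => ?_⟩
    · induction hw using Submodule.span_induction with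
      | mem w hw =>
        obtain ⟨i, rfl⟩ := hw
        exact congrFun h i
      | zero => rfl
      | add a b _ _ ha hb => exact (congrArg₂ (· + ·) ha hb).trans (add_zero 0)
      | smul c a _ ha => exact (congrArg (c • ·) ha).trans (smul_zero c)
    · funext i
      exact h _ (Submodule.subset_span ⟨i, rfl⟩)
  -- The derivative of the inverse chart maps the kernel isomorphically onto `D_L`, so its dimension
  -- is constant.
  have hrank : ∀ z ∈ O,
      Module.finrank ℝ (LinearMap.ker (formFrame x₀ s z : E →ₗ[ℝ] (Fin k → ℝ))) = r := by
    intro z hz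
    obtain ⟨g, hg⟩ := isInvertible_mfderiv_extChartAt_symm (E := E) hz.1
    rw [← hr (e.symm z)]
    refine LinearEquiv.finrank_eq (LinearEquiv.ofSubmodules g.toLinearEquiv _ _ ?_)
    ext w
    obtain ⟨v, rfl⟩ := g.surjective w
    have h2 := hker z hz v
    rw [← hg] at h2
    constructor
    · rintro ⟨v', hv', hvv⟩
      obtain rfl : v' = v := g.injective hvv
      exact h2.1 hv'
    · exact fun hv => ⟨v, h2.2 hv, rfl⟩
  obtain ⟨T, π, H, O', hO', hzO', hsub, hH, hprop⟩ :=
    exists_splitting_of_finrank_ker_eq hO hz₀ (fun z hz => (hform z hz).contDiffWithinAt) hrank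
  refine ⟨k, s, T, π, H, ?_, ?_⟩
  · filter_upwards [hU.mem_nhds hx₀] with y hy i
    refine ⟨(hs i).1.smoothFieldAt (hU.mem_nhds hy), ?_⟩
    rw [← (hspan y hy).2]
    exact Submodule.subset_span ⟨i, rfl⟩
  · filter_upwards [hO'.mem_nhds hzO'] with z hz
    exact ⟨(hsub hz).1, hform z (hsub hz), hH.contDiffAt (hO'.mem_nhds hz), (hprop z hz).1,
      (hprop z hz).2.1, (hprop z hz).2.2, hker z (hsub hz)⟩

/-- A vector in a regular characteristic distribution extends to a local smooth section. -/
theorem IsDirac.exists_extension {L : Π x : M, Submodule ℝ (GenTangent E x)}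
    (hL : IsDirac L) (hr : ∃ r : ℕ, ∀ x : M, Module.finrank ℝ (charDist L x) = r) (x₀ : M)
    {X₀ : TangentSpace 𝓘(ℝ, E) x₀} (hX₀ : X₀ ∈ charDist L x₀) :
    ∃ V : E → E, (V (extChartAt 𝓘(ℝ, E) x₀ x₀) : E) =
        mfderiv 𝓘(ℝ, E) 𝓘(ℝ, E) (extChartAt 𝓘(ℝ, E) x₀) x₀ X₀ ∧
      ∀ᶠ z in 𝓝 (extChartAt 𝓘(ℝ, E) x₀ x₀), z ∈ (extChartAt 𝓘(ℝ, E) x₀).target ∧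
        ContDiffAt ℝ ∞ V z ∧ mfderiv 𝓘(ℝ, E) 𝓘(ℝ, E) (extChartAt 𝓘(ℝ, E) x₀).symm z (V z) ∈
          charDist L ((extChartAt 𝓘(ℝ, E) x₀).symm z) := by
  obtain ⟨k, s, T, π, H, -, hev⟩ := hL.exists_local_splitting hr x₀
  set v₀ : E := mfderiv 𝓘(ℝ, E) 𝓘(ℝ, E) (extChartAt 𝓘(ℝ, E) x₀) x₀ X₀ with hv₀
  -- This is the projection of `v₀` along `T` to the kernel of `formFrame x₀ s z`. At the base point
  -- `v₀` already lies in the kernel, so nothing is subtracted.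
  refine ⟨fun z => v₀ - (H z (π (formFrame x₀ s z v₀)) : E), ?_, ?_⟩
  · have h0 : formFrame x₀ s (extChartAt 𝓘(ℝ, E) x₀ x₀) v₀ = 0 := by
      obtain ⟨hz, -, -, -, -, -, h⟩ := hev.self_of_nhds
      rw [h]
      have h1 := mfderiv_symm_mfderiv_extChartAt hz
      rw! [extChartAt_to_inv (I := 𝓘(ℝ, E)) x₀] at h1
      rw! [extChartAt_to_inv (I := 𝓘(ℝ, E)) x₀]
      rw [hv₀]
      exact (h1 X₀).symm ▸ hX₀
    simp only [h0, map_zero, Submodule.coe_zero, sub_zero]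
  · filter_upwards [hev] with z ⟨hz, hf, hH, h1, h2, h3, h4⟩
    refine ⟨hz, ?_, (h4 _).1 (h3 _ ?_)⟩
    · exact contDiffAt_const.sub (T.subtypeL.contDiff.contDiffAt.comp z
        (hH.clm_apply (π.contDiff.contDiffAt.comp z (hf.clm_apply contDiffAt_const))))
    · rw [map_sub, map_sub, h2, sub_self]

/-- A smooth one-form annihilating a regular characteristic distribution is locally the one-form
component of a smooth section of the Dirac structure. -/
theorem IsDirac.exists_local_field {L : Π x : M, Submodule ℝ (GenTangent E x)}
    (hL : IsDirac L) (hr : ∃ r : ℕ, ∀ x : M, Module.finrank ℝ (charDist L x) = r) (x₀ : M)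
    {β : Π x : M, Cotangent E x} (hβ : ∀ᶠ y in 𝓝 x₀, SmoothFormAt β y)
    (hβD : ∀ᶠ y in 𝓝 x₀, ∀ X ∈ charDist L y, β y X = 0) :
    ∃ X : Π x : M, TangentSpace 𝓘(ℝ, E) x,
      ∀ᶠ y in 𝓝 x₀, SmoothFieldAt X y ∧ (X y, β y) ∈ L y := by
  obtain ⟨k, s, T, π, H, hs, hev⟩ := hL.exists_local_splitting hr x₀
  set e := extChartAt 𝓘(ℝ, E) x₀ with he
  -- With `A` the form frame, `v - H π A v` lies in `D_L`, where `β` vanishes. So `β = c ∘ A` with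
  -- `c = β ∘ H ∘ π`, and the values of `c` on the standard basis are the coefficients of `β` in the
  -- forms of the frame.
  let c : E → (Fin k → ℝ) →L[ℝ] ℝ := fun z =>
    ((formRep x₀ β z).comp T.subtypeL).comp ((H z).comp π)
  refine ⟨fun y => ∑ i, c (e y) (Pi.single i 1) • (s i y).1,
    eventually_of_extChartAt_symm (E := E) ?_⟩
  filter_upwards [hev, eventually_extChartAt_symm (E := E) hs, eventually_extChartAt_symm (E := E) hβ,
    eventually_extChartAt_symm (E := E) hβD] with z ⟨hz, hf, hH, h1, h2, h3, h4⟩ hs hβ hβD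
  have hright : e (e.symm z) = z := e.right_inv hz
  constructor
  · refine ContMDiffAt.sum_section (V := fun y : M => TangentSpace 𝓘(ℝ, E) y) (I := 𝓘(ℝ, E))
      fun i _ => ContMDiffAt.smul_section ?_ (hs i).1
    have hc : ContDiffAt ℝ ∞ (fun z => c z (Pi.single i 1)) (e (e.symm z)) := by
      rw [hright]
      exact ((((SmoothFormAt.contDiffAt_formRep hz hβ).clm_comp contDiffAt_const).clm_comp
        (hH.clm_comp contDiffAt_const))).clm_apply contDiffAt_const
    refine (contMDiffAt_iff_contDiffAt.2 hc).comp (e.symm z) (contMDiffAt_extChartAt' ?_)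
    rw [← extChartAt_source 𝓘(ℝ, E) x₀]
    exact e.map_target hz
  · have key : (∑ i, c (e (e.symm z)) (Pi.single i 1) • (s i (e.symm z)).1, β (e.symm z)) =
        ∑ i, c (e (e.symm z)) (Pi.single i 1) • s i (e.symm z) := by
      refine Prod.ext (by rw [Prod.fst_sum]; rfl) ?_
      rw [Prod.snd_sum, hright]
      have hform : ∀ v : E, formRep x₀ β z v =
          ∑ i, c z (Pi.single i 1) * formRep x₀ (fun y => (s i y).2) z v := by
        intro v
        have h5 : formRep x₀ β z (v - (H z (π (formFrame x₀ s z v)) : E)) = 0 :=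
          hβD _ ((h4 _).1 (h3 _ (by rw [map_sub, map_sub, h2, sub_self])))
        rw [map_sub, sub_eq_zero] at h5
        have h6 := LinearMap.pi_apply_eq_sum_univ (c z : (Fin k → ℝ) →ₗ[ℝ] ℝ)
          (formFrame x₀ s z v)
        rw [h5]
        refine Eq.trans h6 (Finset.sum_congr rfl fun i _ => ?_)
        rw [smul_eq_mul, mul_comm]
        refine congrArg₂ (· * ·) (congrArg (c z) ?_) rfl
        funext j
        simp [Pi.single_apply, eq_comm]
      ext u
      have h7 := mfderiv_symm_mfderiv_extChartAt hz u
      have h8 := hform (mfderiv 𝓘(ℝ, E) 𝓘(ℝ, E) e (e.symm z) u)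
      have h9 : ∀ γ : Π y : M, Cotangent E y, formRep x₀ γ z
          (mfderiv 𝓘(ℝ, E) 𝓘(ℝ, E) e (e.symm z) u) = γ (e.symm z) u := fun γ =>
        congrArg _ h7
      simp only [h9] at h8
      rw [h8, sum_apply]
      rfl
    rw [key]
    exact Submodule.sum_mem _ fun i _ => Submodule.smul_mem _ _ (hs i).2

end LocalFrames

/-! ### Leaves, functions constant on them, and Hamiltonian sections -/

section Leaves

/-- Integral curves of smooth vector fields are smooth. -/
theorem contDiffOn_of_hasDerivAt_comp {E : Type*} [NormedAddCommGroup E] [NormedSpace ℝ E]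
    {V : E → E} {O : Set E} {I : Set ℝ} {γ : ℝ → E} (hI : IsOpen I)
    (hV : ContDiffOn ℝ ∞ V O) (hγ : ∀ t ∈ I, HasDerivAt γ (V (γ t)) t) (hO : MapsTo γ I O) :
    ContDiffOn ℝ ∞ γ I := by
  rw [contDiffOn_infty]
  intro n
  -- Bootstrapping: if `γ` is `C^n`, so is its derivative `V ∘ γ`.
  induction n with
  | zero =>
    exact contDiffOn_zero.2 fun t ht => (hγ t ht).continuousAt.continuousWithinAt
  | succ n ih =>
    rw [Nat.cast_succ, contDiffOn_succ_iff_deriv_of_isOpen hI]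
    refine ⟨fun t ht => (hγ t ht).differentiableAt.differentiableWithinAt, by simp, ?_⟩
    exact ((hV.of_le (by exact_mod_cast le_top)).comp ih hO).congr fun t ht => (hγ t ht).deriv

variable {E : Type*} [NormedAddCommGroup E] [NormedSpace ℝ E] [FiniteDimensional ℝ E]
  {M : Type*} [TopologicalSpace M] [ChartedSpace E M] [IsManifold 𝓘(ℝ, E) ∞ M]

theorem leafProj_eq_of_joinedAlong {L : Π x : M, Submodule ℝ (GenTangent E x)} {x y : M}
    (h : JoinedAlong L x y) : leafProj L x = leafProj L y :=
  Quotient.sound (Relation.EqvGen.rel x y h)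

theorem mfderiv_symm_mfderiv_self (x₀ : M) (v : TangentSpace 𝓘(ℝ, E) x₀) :
    (mfderiv 𝓘(ℝ, E) 𝓘(ℝ, E) (extChartAt 𝓘(ℝ, E) x₀).symm (extChartAt 𝓘(ℝ, E) x₀ x₀)
      (mfderiv 𝓘(ℝ, E) 𝓘(ℝ, E) (extChartAt 𝓘(ℝ, E) x₀) x₀ v) : E) = v := by
  have h1 := mfderiv_symm_mfderiv_extChartAt (mem_extChartAt_target (I := 𝓘(ℝ, E)) x₀)
  rw! [extChartAt_to_inv (I := 𝓘(ℝ, E)) x₀] at h1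
  exact h1 v

/-- Vectors in the characteristic distribution are tangent to the fibres of the projection to the
leaf space. -/
theorem IsDirac.mfderiv_leafProj_eq_zero {E' : Type*} [NormedAddCommGroup E'] [NormedSpace ℝ E']
    {L : Π x : M, Submodule ℝ (GenTangent E x)} [ChartedSpace E' (LeafSpace L)]
    (hL : IsDirac L) (hr : ∃ r : ℕ, ∀ x : M, Module.finrank ℝ (charDist L x) = r)
    (hp : ContMDiff 𝓘(ℝ, E) 𝓘(ℝ, E') ∞ (leafProj L)) {x₀ : M}
    {X₀ : TangentSpace 𝓘(ℝ, E) x₀} (hX₀ : X₀ ∈ charDist L x₀) :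
    mfderiv 𝓘(ℝ, E) 𝓘(ℝ, E') (leafProj L) x₀ X₀ = 0 := by
  have : CompleteSpace E := FiniteDimensional.complete ℝ E
  obtain ⟨V, hV₀, hev⟩ := hL.exists_extension hr x₀ hX₀
  set e := extChartAt 𝓘(ℝ, E) x₀ with he
  obtain ⟨O, hOsub, hO, hz₀⟩ := eventually_nhds_iff.1 hev
  have hVO : ContDiffOn ℝ ∞ V O := fun z hz => (hOsub z hz).2.1.contDiffWithinAt
  obtain ⟨γ, hγ0, ε, hε, hγ⟩ :=
    (((hOsub _ hz₀).2.1.of_le (m := 1) (by simp)).exists_forall_mem_closedBall_exists_eq_forall_mem_Ioo_hasDerivAt₀ 0)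
  have hcont : ContinuousAt γ 0 := (hγ 0 (by constructor <;> linarith)).continuousAt
  obtain ⟨δ', hδ', hball⟩ := Metric.mem_nhds_iff.1
    (hcont.preimage_mem_nhds (by rw [hγ0]; exact hO.mem_nhds hz₀))
  -- For `|t| < δ` the integral curve exists and stays in `O`, where `V` is smooth and tangent to
  -- `D_L`.
  set δ := min ε δ' with hδdef
  have hδ : 0 < δ := lt_min hε hδ'
  set I : Set ℝ := Ioo (-δ) δ with hI
  have hγI : ∀ t ∈ I, HasDerivAt γ (V (γ t)) t := fun t ht =>
    hγ t ⟨by linarith [ht.1, min_le_left ε δ'], by linarith [ht.2, min_le_left ε δ']⟩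
  have hmaps : MapsTo γ I O := fun t ht => hball (by
    rw [Metric.mem_ball, dist_zero_right, Real.norm_eq_abs, abs_lt]
    exact ⟨by linarith [ht.1, min_le_right ε δ'], by linarith [ht.2, min_le_right ε δ']⟩)
  have hγs := contDiffOn_of_hasDerivAt_comp isOpen_Ioo hVO hγI hmaps
  have hmf : ∀ (τ : ℝ → ℝ) (s τ' : ℝ) (z : E), γ (τ s) = z → τ s ∈ I → HasDerivAt τ τ' s →
      mfderiv 𝓘(ℝ, ℝ) 𝓘(ℝ, E) (e.symm ∘ (γ ∘ τ)) s (1 : ℝ) =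
        (τ' • mfderiv 𝓘(ℝ, E) 𝓘(ℝ, E) e.symm z (V z) : E) := by
    rintro τ s τ' _ rfl hs hτ
    have h1 : HasDerivAt (γ ∘ τ) (τ' • V (γ (τ s))) s := (hγI _ hs).scomp s hτ
    have h2 := mfderiv_comp_apply s (v := (1 : ℝ))
      (mdifferentiableAt_extChartAt_symm (hOsub _ (hmaps hs)).1 :
        MDifferentiableAt 𝓘(ℝ, E) 𝓘(ℝ, E) e.symm ((γ ∘ τ) s))
      h1.differentiableAt.mdifferentiableAt
    rw [h2, mfderiv_eq_fderiv, h1.hasFDerivAt.fderiv]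
    have h3 : (ContinuousLinearMap.toSpanSingleton ℝ (τ' • V (γ (τ s)))) (1 : ℝ) =
      τ' • V (γ (τ s)) := by simp
    refine (congrArg (mfderiv 𝓘(ℝ, E) 𝓘(ℝ, E) e.symm (γ (τ s))) h3).trans ?_
    exact map_smul (mfderiv 𝓘(ℝ, E) 𝓘(ℝ, E) e.symm (γ (τ s))) τ' (V (γ (τ s)))
  have hsm : ∀ τ : ℝ → ℝ, ContDiff ℝ ∞ τ → (∀ s, τ s ∈ I) →
      ContMDiff 𝓘(ℝ, ℝ) 𝓘(ℝ, E) ∞ (e.symm ∘ (γ ∘ τ)) := by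
    intro τ hτ hτI s
    refine (contMDiffAt_extChartAt_symm (hOsub _ (hmaps (hτI s))).1).comp s ?_
    rw [contMDiffAt_iff_contDiffAt]
    exact (hγs.contDiffAt (isOpen_Ioo.mem_nhds (hτI s))).comp s hτ.contDiffAt
  have hsin : ∀ a : ℝ, δ / 2 * Real.sin a ∈ I := fun a => by
    constructor <;> nlinarith [Real.neg_one_le_sin a, Real.sin_le_one a]
  -- `JoinedAlong` asks for a curve defined on all of `ℝ`, while `γ` is controlled only on `(-δ,
  -- δ)`. The parameter `δ / 2 * sin` never leaves this interval; with `sin (s * t)` the curve is at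
  -- `x₀` for `s = 0` and at the desired point for `s = 1`.
  have hjoin : ∀ t, leafProj L (e.symm (γ (δ / 2 * Real.sin t))) = leafProj L x₀ := by
    intro t
    refine (leafProj_eq_of_joinedAlong ⟨e.symm ∘ (γ ∘ fun s => δ / 2 * Real.sin (s * t)),
      hsm _ (by fun_prop) fun s => hsin _, fun s => ?_, ?_, ?_⟩).symm
    · have h1 : HasDerivAt (fun s => δ / 2 * Real.sin (s * t))
          (δ / 2 * (Real.cos (s * t) * (1 * t))) s :=
        (((hasDerivAt_id s).mul_const t).sin).const_mul _
      rw [hmf _ s _ _ rfl (hsin _) h1]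
      exact Submodule.smul_mem _ _ (hOsub _ (hmaps (hsin _))).2.2
    · simp [hγ0, he]
    · simp
  have hη := hsm (fun t => δ / 2 * Real.sin t) (by fun_prop) hsin
  have h0 : (e.symm ∘ (γ ∘ fun t => δ / 2 * Real.sin t)) 0 = x₀ := by simp [hγ0, he]
  have h1 : HasDerivAt (fun t => δ / 2 * Real.sin t) (δ / 2 * Real.cos 0) 0 :=
    (Real.hasDerivAt_sin 0).const_mul _
  have h2 := hmf (fun t => δ / 2 * Real.sin t) 0 _ (e x₀) (by simp [hγ0]) (hsin _) h1
  have h3 : (mfderiv 𝓘(ℝ, E) 𝓘(ℝ, E) e.symm (e x₀) (V (e x₀)) : E) = X₀ := by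
    rw [hV₀]
    exact mfderiv_symm_mfderiv_self x₀ X₀
  have h4 := mfderiv_comp_apply_of_eq (0 : ℝ) (hp.mdifferentiableAt (x := x₀) (by simp))
    (hη.mdifferentiableAt (x := 0) (by simp)) h0 (1 : ℝ)
  -- The projected curve is constant, and the velocity at `0` before projection is `δ / 2` times
  -- `X₀`.
  have h5 : leafProj L ∘ (e.symm ∘ (γ ∘ fun t => δ / 2 * Real.sin t)) =
      fun _ => leafProj L x₀ := funext hjoin
  rw [h5, mfderiv_const] at h4
  have h6 := congrArg (mfderiv 𝓘(ℝ, E) 𝓘(ℝ, E') (leafProj L) x₀) (h2.trans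
    (congrArg ((δ / 2 * Real.cos 0) • ·) h3))
  have h7 := (map_smul (mfderiv 𝓘(ℝ, E) 𝓘(ℝ, E') (leafProj L) x₀) (δ / 2 * Real.cos 0) X₀)
  have h8 := (h4.trans h6).trans h7
  have h9 : δ / 2 * Real.cos 0 ≠ 0 := by simp [hδ.ne']
  exact (smul_eq_zero.1 h8.symm).resolve_left h9

/-- A smooth function whose differential annihilates the characteristic distribution is constant
on the leaves. -/
theorem eq_of_leafProj_eq {L : Π x : M, Submodule ℝ (GenTangent E x)} {u : M → ℝ}
    (hu : SmoothFun E u) (h : ∀ x, ∀ X ∈ charDist L x, mvfderiv 𝓘(ℝ, E) u x X = 0) {x y : M}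
    (hxy : leafProj L x = leafProj L y) : u x = u y := by
  have hgen : Relation.EqvGen (JoinedAlong L) x y := Quotient.exact hxy
  induction hgen with
  | rel x y hj =>
    obtain ⟨γ, hγ, htan, rfl, rfl⟩ := hj
    have hd : ∀ t, fderiv ℝ (u ∘ γ) t = 0 := by
      intro t
      ext
      rw [← mfderiv_eq_fderiv]
      have h1 := mfderiv_comp_apply t (hu.mdifferentiableAt (x := γ t) (by simp))
        (hγ.mdifferentiableAt (x := t) (by simp)) (1 : ℝ)
      exact h1.trans (h _ _ (htan t))
    exact is_const_of_fderiv_eq_zero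
      ((contMDiff_iff_contDiff.1 (hu.comp hγ)).differentiable (by simp)) hd 0 1
  | refl => rfl
  | symm x y _ ih => exact (ih (Quotient.sound ‹_›)).symm
  | trans x y z _ _ ih1 ih2 => exact (ih1 (Quotient.sound ‹_›)).trans (ih2 (Quotient.sound ‹_›))

/-- The Courant bracket of two Hamiltonian sections. -/
theorem IsDirac.mlieBracket_mem {L : Π x : M, Submodule ℝ (GenTangent E x)} (hL : IsDirac L)
    {f g : M → ℝ} {X Y : Π x : M, TangentSpace 𝓘(ℝ, E) x} (hf : SmoothFun E f)
    (hg : SmoothFun E g) (hX : IsHamiltonianField L f X) (hY : IsHamiltonianField L g Y) (x : M) :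
    (mlieBracket 𝓘(ℝ, E) X Y x,
      mvfderiv 𝓘(ℝ, E) (fun y => mvfderiv 𝓘(ℝ, E) g y (X y)) x) ∈ L x := by
  -- With `w = X g`, isotropy gives `Y f = -w`. The covector part of the Courant bracket is then `dw
  -- + dw - dw = dw`.
  have hiso : ∀ y, mvfderiv 𝓘(ℝ, E) f y (Y y) = - mvfderiv 𝓘(ℝ, E) g y (X y) := fun y =>
    eq_neg_of_add_eq_zero_right (hL.pairing_eq_zero (hX.2 y) (hY.2 y))
  have h := hL.integrable (fun y => (X y, mvfderiv 𝓘(ℝ, E) f y))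
    (fun y => (Y y, mvfderiv 𝓘(ℝ, E) g y))
    ⟨hX.1, smoothFormOn_of_forall fun y _ => hf.smoothFormAt_mvfderiv y⟩
    ⟨hY.1, smoothFormOn_of_forall fun y _ => hg.smoothFormAt_mvfderiv y⟩ hX.2 hY.2 x
  rw [courantBracket] at h
  convert h using 2
  rw [lieDerivForm_mvfderiv hX.1 hg, lieDerivForm_mvfderiv hY.1 hf]
  simp only [hiso]
  set w : M → ℝ := fun y => mvfderiv 𝓘(ℝ, E) g y (X y) with hw
  have h1 : mvfderiv 𝓘(ℝ, E) (fun y => - w y) x = - mvfderiv 𝓘(ℝ, E) w x := mvfderiv_neg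
  have h2 : mvfderiv 𝓘(ℝ, E) (fun y => - w y - w y) x = - (2 : ℝ) • mvfderiv 𝓘(ℝ, E) w x := by
    have hwd : MDifferentiableAt 𝓘(ℝ, E) 𝓘(ℝ, ℝ) w x :=
      (hg.contMDiffAt_mvfderiv_apply (hX.1.smoothFieldAt Filter.univ_mem)).mdifferentiableAt
        (by simp)
    have := mvfderiv_sub hwd.neg hwd
    refine this.trans ?_
    rw [mvfderiv_neg]
    module
  rw [h1, h2]
  module

end Leaves

/-! ### Local sections of submersions and functions with given differential -/

section LocalConstructions

variable {E : Type*} [NormedAddCommGroup E] [NormedSpace ℝ E]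
  {M : Type*} [TopologicalSpace M] [ChartedSpace E M] [IsManifold 𝓘(ℝ, E) ∞ M]
  {F : Type*} [NormedAddCommGroup F] [NormedSpace ℝ F]
  {N : Type*} [TopologicalSpace N] [ChartedSpace F N] [IsManifold 𝓘(ℝ, F) ∞ N]

/-- Submersions have smooth local sections. -/
theorem exists_local_section {p : M → N} {x : M}
    (h : Manifold.IsSubmersionAt 𝓘(ℝ, E) 𝓘(ℝ, F) ∞ p x) :
    ∃ σ : N → M, σ (p x) = x ∧
      ∀ᶠ q in 𝓝 (p x), ContMDiffAt 𝓘(ℝ, F) 𝓘(ℝ, E) ∞ σ q ∧ p (σ q) = q := by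
  set e₁ := h.domChart with he₁
  set e₂ := h.codChart with he₂
  have hw : ∀ z ∈ e₁.target, e₂ (p (e₁.symm z)) = (h.equiv z).1 := fun z hz =>
    h.writtenInCharts (by simpa using hz)
  have hx := h.mem_domChart_source
  have hpx := h.mem_codChart_source
  -- In adapted charts `p` is a projection onto the first factor; the section freezes the second
  -- coordinate at its value at `x`.
  set w : N → E := fun q => h.equiv.symm (e₂ q, (h.equiv (e₁ x)).2) with hwdef
  have hwx : w (p x) = e₁ x := by
    have := hw (e₁ x) (e₁.map_source hx)
    rw [e₁.left_inv hx] at this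
    rw [hwdef]
    simp only [this, Prod.mk.eta, ContinuousLinearEquiv.symm_apply_apply]
  have hwsm : ∀ q ∈ e₂.source, ContMDiffAt 𝓘(ℝ, F) 𝓘(ℝ, E) ∞ w q := fun q hq =>
    (h.equiv.symm.contDiff.contMDiff.contMDiffAt).comp q
      (ContMDiffAt.prodMk_space (contMDiffAt_of_mem_maximalAtlas h.codChart_mem_maximalAtlas hq)
        contMDiffAt_const)
  refine ⟨fun q => e₁.symm (w q), by simp only [hwx, e₁.left_inv hx], ?_⟩
  have hev : ∀ᶠ q in 𝓝 (p x), w q ∈ e₁.target :=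
    (hwsm _ hpx).continuousAt.eventually_mem
      (by rw [hwx]; exact e₁.open_target.mem_nhds (e₁.map_source hx))
  filter_upwards [hev, e₂.open_source.mem_nhds hpx] with q hq hq₂
  refine ⟨(contMDiffAt_symm_of_mem_maximalAtlas h.domChart_mem_maximalAtlas hq).comp q
    (hwsm q hq₂), e₂.injOn (h.source_subset_preimage_source (e₁.map_target hq)) hq₂ ?_⟩
  rw [hw _ hq, hwdef]
  simp

/-- Every covector is the differential of a smooth function. -/
theorem exists_smoothFun_mvfderiv_eq [FiniteDimensional ℝ E] [T2Space M] (x : M)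
    (ξ : Cotangent E x) : ∃ f : M → ℝ, SmoothFun E f ∧ mvfderiv 𝓘(ℝ, E) f x = ξ := by
  let b : SmoothBumpFunction 𝓘(ℝ, E) x := Classical.arbitrary _
  let ℓ : E →L[ℝ] ℝ := (show E →L[ℝ] ℝ from ξ).comp
    (show E →L[ℝ] E from mfderiv 𝓘(ℝ, E) 𝓘(ℝ, E) (extChartAt 𝓘(ℝ, E) x).symm
      (extChartAt 𝓘(ℝ, E) x x))
  have hsm : ContMDiffOn 𝓘(ℝ, E) 𝓘(ℝ, ℝ) ∞ (ℓ ∘ extChartAt 𝓘(ℝ, E) x) (chartAt E x).source :=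
    fun y hy => (ℓ.contDiff.contMDiff.contMDiffAt.comp y
      (contMDiffAt_extChartAt' hy)).contMDiffWithinAt
  refine ⟨fun y => b y • (ℓ ∘ extChartAt 𝓘(ℝ, E) x) y, b.contMDiff_smul hsm, ?_⟩
  have hev : (fun y => b y • (ℓ ∘ extChartAt 𝓘(ℝ, E) x) y) =ᶠ[𝓝 x]
      (ℓ ∘ extChartAt 𝓘(ℝ, E) x) := by
    filter_upwards [b.eventuallyEq_one] with y hy
    rw [hy]
    simp
  ext v
  have h1 : mvfderiv 𝓘(ℝ, E) (fun y => b y • (ℓ ∘ extChartAt 𝓘(ℝ, E) x) y) x v =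
      mvfderiv 𝓘(ℝ, E) (ℓ ∘ extChartAt 𝓘(ℝ, E) x) x v :=
    DFunLike.congr_fun (hev.mfderiv_eq (I := 𝓘(ℝ, E)) (I' := 𝓘(ℝ, ℝ))) v
  have h2 := mvfderiv_comp_apply x (I := 𝓘(ℝ, E)) (I' := 𝓘(ℝ, E)) (g := ℓ)
    (f := extChartAt 𝓘(ℝ, E) x) ℓ.differentiableAt.mdifferentiableAt
    (mdifferentiableAt_extChartAt (mem_chart_source E x)) v
  have h3 : mvfderiv 𝓘(ℝ, E) ℓ (extChartAt 𝓘(ℝ, E) x x) = ℓ :=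
    mfderiv_eq_fderiv.trans ℓ.fderiv
  rw [h1, h2, h3]
  exact congrArg ξ (mfderiv_symm_mfderiv_self x v)

theorem mvfderiv_comp_eq_pullbackCovector {f : N → ℝ} {φ : M → N} {x : M}
    (hf : SmoothFun F f) (hφ : ContMDiff 𝓘(ℝ, E) 𝓘(ℝ, F) ∞ φ) :
    mvfderiv 𝓘(ℝ, E) (f ∘ φ) x = pullbackCovector E F φ x (mvfderiv 𝓘(ℝ, F) f (φ x)) :=
  mvfderiv_comp x (hf.mdifferentiableAt (by simp)) (hφ.mdifferentiableAt (by simp))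

/-- Smoothness of the Poisson bracket of a smooth bivector field. -/
theorem smoothFun_poissonBracket [FiniteDimensional ℝ E] {π : BivectorField E M}
    (hπ : ContMDiff 𝓘(ℝ, E) (𝓘(ℝ, E).prod 𝓘(ℝ, (E →L[ℝ] ℝ) →L[ℝ] E)) ∞
      (fun x => Bundle.TotalSpace.mk' ((E →L[ℝ] ℝ) →L[ℝ] E)
        (E := fun y : M => Cotangent E y →L[ℝ] TangentSpace 𝓘(ℝ, E) y) x (π x)))
    {f g : M → ℝ} (hf : SmoothFun E f) (hg : SmoothFun E g) :
    SmoothFun E (poissonBracket π f g) := fun x =>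
  hg.contMDiffAt_mvfderiv_apply (X := fun x => π x (mvfderiv 𝓘(ℝ, E) f x))
    (ContMDiffAt.clm_bundle_apply (hπ x) (hf.smoothFormAt_mvfderiv x))

end LocalConstructions

/-! ### Hamiltonian fields of functions pulled back from the leaf space -/

section Reduction

variable {E : Type*} [NormedAddCommGroup E] [NormedSpace ℝ E] [FiniteDimensional ℝ E]
  {E' : Type*} [NormedAddCommGroup E'] [NormedSpace ℝ E']
  {M : Type*} [TopologicalSpace M] [ChartedSpace E M] [IsManifold 𝓘(ℝ, E) ∞ M]
  {L : Π x : M, Submodule ℝ (GenTangent E x)}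
  [ChartedSpace E' (LeafSpace L)] [IsManifold 𝓘(ℝ, E') ∞ (LeafSpace L)]

theorem IsReducibleDirac.contMDiff_leafProj (hL : IsReducibleDirac (E' := E') L) :
    ContMDiff 𝓘(ℝ, E) 𝓘(ℝ, E') ∞ (leafProj L) :=
  hL.submersion.contMDiff

theorem IsReducibleDirac.mfderiv_eq_zero (hL : IsReducibleDirac (E' := E') L) {x : M}
    {X : TangentSpace 𝓘(ℝ, E) x} (hX : X ∈ charDist L x) :
    mfderiv 𝓘(ℝ, E) 𝓘(ℝ, E') (leafProj L) x X = 0 :=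
  hL.dirac.mfderiv_leafProj_eq_zero hL.regular hL.contMDiff_leafProj hX

/-- The projection to the leaf space of the vector component of an element of `L` only depends on
its covector component. -/
theorem IsReducibleDirac.mfderiv_eq_of_mem (hL : IsReducibleDirac (E' := E') L) {x : M}
    {X Y : TangentSpace 𝓘(ℝ, E) x} {α : Cotangent E x} (hX : (X, α) ∈ L x) (hY : (Y, α) ∈ L x) :
    mfderiv 𝓘(ℝ, E) 𝓘(ℝ, E') (leafProj L) x X = mfderiv 𝓘(ℝ, E) 𝓘(ℝ, E') (leafProj L) x Y := by
  rw [← sub_eq_zero, ← map_sub]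
  refine hL.mfderiv_eq_zero ?_
  have := Submodule.sub_mem _ hX hY
  rwa [Prod.mk_sub_mk, sub_self] at this

theorem IsReducibleDirac.pullback_charDist (hL : IsReducibleDirac (E' := E') L) {x : M}
    {X : TangentSpace 𝓘(ℝ, E) x} (hX : X ∈ charDist L x) (ξ : Cotangent E' (leafProj L x)) :
    pullbackCovector E E' (leafProj L) x ξ X = 0 :=
  (congrArg ξ (hL.mfderiv_eq_zero hX)).trans (map_zero ξ)

theorem IsReducibleDirac.smoothFun_comp (hL : IsReducibleDirac (E' := E') L)
    {f : LeafSpace L → ℝ} (hf : SmoothFun E' f) : SmoothFun E (f ∘ leafProj L) :=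
  ContMDiff.comp hf hL.contMDiff_leafProj

/-- Pullbacks of smooth functions on the leaf space have global Hamiltonian vector fields. -/
theorem IsReducibleDirac.exists_isHamiltonianField [T2Space M] [SecondCountableTopology M]
    (hL : IsReducibleDirac (E' := E') L) {f : LeafSpace L → ℝ} (hf : SmoothFun E' f) :
    ∃ X, IsHamiltonianField L (f ∘ leafProj L) X := by
  have : LocallyCompactSpace M := Manifold.locallyCompact_of_finiteDimensional 𝓘(ℝ, E)
  -- The Hamiltonian vectors at a point form an affine, hence convex, set, so a partition of unity
  -- glues local solutions.
  obtain ⟨X, hX⟩ := exists_contMDiffSection_forall_mem_convex_of_local 𝓘(ℝ, E) (n := (⊤ : ℕ∞))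
    (fun x : M => TangentSpace 𝓘(ℝ, E) x)
    (fun x => {X | (X, mvfderiv 𝓘(ℝ, E) (f ∘ leafProj L) x) ∈ L x})
    (fun x X hX Y hY a b _ _ hab => by
      have h := Submodule.add_mem _ (Submodule.smul_mem _ a hX) (Submodule.smul_mem _ b hY)
      rwa [Prod.smul_mk, Prod.smul_mk, Prod.mk_add_mk, ← add_smul, hab, one_smul] at h)
    (fun x₀ => by
      obtain ⟨X, hX⟩ := hL.dirac.exists_local_field hL.regular x₀
        (β := mvfderiv 𝓘(ℝ, E) (f ∘ leafProj L))
        (Filter.Eventually.of_forall fun y => (hL.smoothFun_comp hf).smoothFormAt_mvfderiv y)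
        (Filter.Eventually.of_forall fun y X hX => by
          rw [mvfderiv_comp_eq_pullbackCovector hf hL.contMDiff_leafProj]
          exact hL.pullback_charDist hX _)
      exact ⟨_, hX, X, fun y hy => hy.1.contMDiffWithinAt, fun y hy => hy.2⟩)
  exact ⟨X, X.contMDiff.contMDiffOn, hX⟩

/-- Brackets of pullbacks of functions on the leaf space are constant on the leaves. -/
theorem IsReducibleDirac.bracket_eq_of_leafProj_eq (hL : IsReducibleDirac (E' := E') L)
    [T2Space M] [SecondCountableTopology M]
    {f g : LeafSpace L → ℝ} (hf : SmoothFun E' f) (hg : SmoothFun E' g)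
    {X : Π x : M, TangentSpace 𝓘(ℝ, E) x} (hX : IsHamiltonianField L (f ∘ leafProj L) X)
    {x y : M} (hxy : leafProj L x = leafProj L y) :
    mvfderiv 𝓘(ℝ, E) (g ∘ leafProj L) x (X x) = mvfderiv 𝓘(ℝ, E) (g ∘ leafProj L) y (X y) := by
  obtain ⟨Y, hY⟩ := hL.exists_isHamiltonianField hg
  have hg' := hL.smoothFun_comp hg
  refine eq_of_leafProj_eq (E := E) (u := fun x => mvfderiv 𝓘(ℝ, E) (g ∘ leafProj L) x (X x))
    (fun x => hg'.contMDiffAt_mvfderiv_apply (hX.1.smoothFieldAt Filter.univ_mem))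
    (fun x Z hZ => ?_) hxy
  -- The differential of `X(p^*g)` is the covector part of an element of `L`, so it annihilates
  -- `D_L`.
  exact hL.dirac.mem_charDist_iff.1 hZ _
    (hL.dirac.mlieBracket_mem (hL.smoothFun_comp hf) hg' hX hY x)

variable [FiniteDimensional ℝ E'] [T2Space M] [SecondCountableTopology M] [T2Space (LeafSpace L)]

theorem IsReducibleDirac.exists_mem_pullback (hL : IsReducibleDirac (E' := E') L) (x : M)
    (ξ : Cotangent E' (leafProj L x)) :
    ∃ X, (X, pullbackCovector E E' (leafProj L) x ξ) ∈ L x := by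
  obtain ⟨f, hf, rfl⟩ := exists_smoothFun_mvfderiv_eq (leafProj L x) ξ
  obtain ⟨X, hX⟩ := hL.exists_isHamiltonianField hf
  refine ⟨X x, ?_⟩
  rw [← mvfderiv_comp_eq_pullbackCovector hf hL.contMDiff_leafProj]
  exact hX.2 x

/-- A bivector field on the leaf space that induces the bracket of admissible functions is
determined by `L` pointwise. -/
theorem IsReducibleDirac.apply_eq_of_bracket (hL : IsReducibleDirac (E' := E') L)
    {π : BivectorField E' (LeafSpace L)}
    (hπ : ∀ f g : LeafSpace L → ℝ, SmoothFun E' f → SmoothFun E' g →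
      ∀ X, IsHamiltonianField L (f ∘ leafProj L) X →
        ∀ x, poissonBracket π f g (leafProj L x) = mvfderiv 𝓘(ℝ, E) (g ∘ leafProj L) x (X x))
    {x : M} {ξ : Cotangent E' (leafProj L x)} {X : TangentSpace 𝓘(ℝ, E) x}
    (hX : (X, pullbackCovector E E' (leafProj L) x ξ) ∈ L x) :
    π (leafProj L x) ξ = mfderiv 𝓘(ℝ, E) 𝓘(ℝ, E') (leafProj L) x X := by
  obtain ⟨f, hf, rfl⟩ := exists_smoothFun_mvfderiv_eq (leafProj L x) ξ
  obtain ⟨Y, hY⟩ := hL.exists_isHamiltonianField hf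
  rw [hL.mfderiv_eq_of_mem (E' := E') hX (by
    rw [← mvfderiv_comp_eq_pullbackCovector hf hL.contMDiff_leafProj]; exact hY.2 x)]
  -- Covectors separate tangent vectors and each is some `dg`, so the bracket identity determines
  -- the value of `π`.
  refine (SeparatingDual.eq_iff_forall_dual_eq (R := ℝ) (V := E')).2 fun η => ?_
  obtain ⟨g, hg, hgη⟩ := exists_smoothFun_mvfderiv_eq (leafProj L x)
    (show Cotangent E' (leafProj L x) from η)
  have h := hπ f g hf hg Y hY x
  rw [poissonBracket, hgη, mvfderiv_comp_eq_pullbackCovector hg hL.contMDiff_leafProj, hgη] at h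
  exact h

end Reduction

/-! ### Existence and uniqueness of the reduced Poisson structure -/

section ReducedPoisson

variable {E : Type*} [NormedAddCommGroup E] [NormedSpace ℝ E] [FiniteDimensional ℝ E]
  {E' : Type*} [NormedAddCommGroup E'] [NormedSpace ℝ E'] [FiniteDimensional ℝ E']
  {M : Type*} [TopologicalSpace M] [T2Space M] [SecondCountableTopology M]
  [ChartedSpace E M] [IsManifold 𝓘(ℝ, E) ∞ M]
  {L : Π x : M, Submodule ℝ (GenTangent E x)} [T2Space (LeafSpace L)]
  [ChartedSpace E' (LeafSpace L)] [IsManifold 𝓘(ℝ, E') ∞ (LeafSpace L)]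

theorem leafProj_surjective (L : Π x : M, Submodule ℝ (GenTangent E x)) :
    Function.Surjective (leafProj L) := Quotient.mk_surjective

/-- The bracket of admissible functions is induced by a bivector field on the leaf space. -/
theorem IsReducibleDirac.exists_bivectorField (hL : IsReducibleDirac (E' := E') L) :
    ∃ π : BivectorField E' (LeafSpace L),
      ∀ f g : LeafSpace L → ℝ, SmoothFun E' f → SmoothFun E' g →
        ∀ X, IsHamiltonianField L (f ∘ leafProj L) X →
          ∀ x, poissonBracket π f g (leafProj L x) =
            mvfderiv 𝓘(ℝ, E) (g ∘ leafProj L) x (X x) := by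
  have key : ∀ q : LeafSpace L, ∃ A : Cotangent E' q →L[ℝ] TangentSpace 𝓘(ℝ, E') q,
      ∀ f g : LeafSpace L → ℝ, SmoothFun E' f → SmoothFun E' g →
        ∀ X, IsHamiltonianField L (f ∘ leafProj L) X → ∀ x, leafProj L x = q →
          mvfderiv 𝓘(ℝ, E') g q (A (mvfderiv 𝓘(ℝ, E') f q)) =
            mvfderiv 𝓘(ℝ, E) (g ∘ leafProj L) x (X x) := by
    intro q
    obtain ⟨x, rfl⟩ := leafProj_surjective L q
    choose X hX using hL.exists_mem_pullback x
    have hadd : ∀ ξ η : Cotangent E' (leafProj L x),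
        mfderiv 𝓘(ℝ, E) 𝓘(ℝ, E') (leafProj L) x (X (ξ + η)) =
          mfderiv 𝓘(ℝ, E) 𝓘(ℝ, E') (leafProj L) x (X ξ) +
            mfderiv 𝓘(ℝ, E) 𝓘(ℝ, E') (leafProj L) x (X η) := fun ξ η => by
      have h := Submodule.add_mem _ (hX ξ) (hX η)
      rw [Prod.mk_add_mk, ← map_add] at h
      exact (hL.mfderiv_eq_of_mem (hX (ξ + η)) h).trans (map_add _ _ _)
    have hsmul : ∀ (c : ℝ) (ξ : Cotangent E' (leafProj L x)),
        mfderiv 𝓘(ℝ, E) 𝓘(ℝ, E') (leafProj L) x (X (c • ξ)) =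
          c • mfderiv 𝓘(ℝ, E) 𝓘(ℝ, E') (leafProj L) x (X ξ) := fun c ξ => by
      have h := Submodule.smul_mem _ c (hX ξ)
      rw [Prod.smul_mk, ← map_smul] at h
      exact (hL.mfderiv_eq_of_mem (hX (c • ξ)) h).trans (map_smul _ _ _)
    let A : (E' →L[ℝ] ℝ) →ₗ[ℝ] E' :=
      { toFun := fun ξ => mfderiv 𝓘(ℝ, E) 𝓘(ℝ, E') (leafProj L) x (X ξ)
        map_add' := hadd
        map_smul' := hsmul }
    refine ⟨A.toContinuousLinearMap, fun f g hf hg Y hY y hy => ?_⟩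
    -- `A` is built at the chosen representative `x`; constancy of the bracket on leaves moves the
    -- claim from `y` to `x`.
    rw [hL.bracket_eq_of_leafProj_eq hf hg hY hy,
      mvfderiv_comp_eq_pullbackCovector hg hL.contMDiff_leafProj]
    refine congrArg (mvfderiv 𝓘(ℝ, E') g (leafProj L x)) (hL.mfderiv_eq_of_mem (hX _) ?_)
    rw [← mvfderiv_comp_eq_pullbackCovector hf hL.contMDiff_leafProj]
    exact hY.2 x
  choose π hπ using key
  exact ⟨π, fun f g hf hg X hX x => hπ _ f g hf hg X hX x rfl⟩

/-- The bivector field inducing the bracket of admissible functions is a Poisson structure. -/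
theorem IsReducibleDirac.isPoisson_of_bracket (hL : IsReducibleDirac (E' := E') L)
    {π : BivectorField E' (LeafSpace L)}
    (hπ : ∀ f g : LeafSpace L → ℝ, SmoothFun E' f → SmoothFun E' g →
      ∀ X, IsHamiltonianField L (f ∘ leafProj L) X →
        ∀ x, poissonBracket π f g (leafProj L x) = mvfderiv 𝓘(ℝ, E) (g ∘ leafProj L) x (X x)) :
    IsPoisson π := by
  have hskew : ∀ (q : LeafSpace L) (α β : Cotangent E' q), β (π q α) = - α (π q β) := by
    intro q α β
    obtain ⟨x, rfl⟩ := leafProj_surjective L q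
    obtain ⟨X, hX⟩ := hL.exists_mem_pullback x α
    obtain ⟨Y, hY⟩ := hL.exists_mem_pullback x β
    rw [hL.apply_eq_of_bracket hπ hX, hL.apply_eq_of_bracket hπ hY]
    exact eq_neg_of_add_eq_zero_left (hL.dirac.pairing_eq_zero hX hY)
  have hsmooth : ContMDiff 𝓘(ℝ, E') (𝓘(ℝ, E').prod 𝓘(ℝ, (E' →L[ℝ] ℝ) →L[ℝ] E')) ∞
      (fun q => Bundle.TotalSpace.mk' ((E' →L[ℝ] ℝ) →L[ℝ] E')
        (E := fun y : LeafSpace L => Cotangent E' y →L[ℝ] TangentSpace 𝓘(ℝ, E') y) q (π q)) := by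
    intro q
    obtain ⟨x, rfl⟩ := leafProj_surjective L q
    refine contMDiffAt_hom_of_forall (E₁ := fun y : LeafSpace L => Cotangent E' y)
      (E₂ := fun y : LeafSpace L => TangentSpace 𝓘(ℝ, E') y) fun s hs => ?_
    -- For a local field `X` with `X + p^*s ∈ L`, `π s` at `r` equals `p_* X` at `σ r`, which is
    -- smooth in `r`.
    obtain ⟨σ, hσx, hσ⟩ := exists_local_section (hL.submersion.isSubmersionAt x)
    have hp := hL.contMDiff_leafProj
    obtain ⟨X, hX⟩ := hL.dirac.exists_local_field hL.regular x
      (β := fun y => pullbackCovector E E' (leafProj L) y (s (leafProj L y)))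
      (by
        filter_upwards [hp.continuous.continuousAt.eventually hs] with y hy
        exact ContMDiff.smoothFormAt_pullback hp hy)
      (Filter.Eventually.of_forall fun y Y hY => hL.pullback_charDist hY _)
    have hσ0 := hσ.self_of_nhds.1
    have hXσ := ContMDiff.contMDiffAt_mfderiv_apply hp (b := σ) (X := fun q => X (σ q))
      (q₀ := leafProj L x) (ContMDiffAt.comp (leafProj L x)
        (g := fun y => Bundle.TotalSpace.mk' E (E := fun y : M => TangentSpace 𝓘(ℝ, E) y) y (X y))
        (by rw [hσx]; exact hX.self_of_nhds.1) hσ0)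
    refine hXσ.congr_of_eventuallyEq ?_
    have hXev : ∀ᶠ q in 𝓝 (leafProj L x), SmoothFieldAt X (σ q) ∧
        (X (σ q), pullbackCovector E E' (leafProj L) (σ q) (s (leafProj L (σ q)))) ∈ L (σ q) :=
      hσ0.continuousAt.eventually (by rw [hσx]; exact hX)
    filter_upwards [hσ, hXev] with q hq hXq
    have h1 := hL.apply_eq_of_bracket hπ hXq.2
    rw [← h1, hq.2]
  refine ⟨hsmooth, hskew, fun f g h hf hg hh q => ?_⟩
  obtain ⟨x, rfl⟩ := leafProj_surjective L q
  obtain ⟨X, hX⟩ := hL.exists_isHamiltonianField hf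
  obtain ⟨Y, hY⟩ := hL.exists_isHamiltonianField hg
  have hfg := smoothFun_poissonBracket hsmooth hf hg
  have hcomp : ∀ {f g : LeafSpace L → ℝ} (_ : SmoothFun E' f) (_ : SmoothFun E' g)
      {X : Π x : M, TangentSpace 𝓘(ℝ, E) x} (_ : IsHamiltonianField L (f ∘ leafProj L) X),
      poissonBracket π f g ∘ leafProj L =
        fun y => mvfderiv 𝓘(ℝ, E) (g ∘ leafProj L) y (X y) :=
    fun hf hg X hX => funext fun y => hπ _ _ hf hg X hX y
  -- With `h` pulled back to `M`, the three terms of the Jacobi sum are `X(Y h)`, `-Y(X h)` and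
  -- `-[X, Y] h`. The last holds because `[X, Y]` is paired in `L` with the pullback of `d{f, g}`.
  have h1 : poissonBracket π f (poissonBracket π g h) (leafProj L x) =
      mvfderiv 𝓘(ℝ, E) (fun y => mvfderiv 𝓘(ℝ, E) (h ∘ leafProj L) y (Y y)) x (X x) := by
    rw [hπ _ _ hf (smoothFun_poissonBracket hsmooth hg hh) X hX x, hcomp hg hh hY]
  have h2 : poissonBracket π g (poissonBracket π h f) (leafProj L x) =
      - mvfderiv 𝓘(ℝ, E) (fun y => mvfderiv 𝓘(ℝ, E) (h ∘ leafProj L) y (X y)) x (Y x) := by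
    have h3 : poissonBracket π h f = fun q => - poissonBracket π f h q :=
      funext fun q => hskew q _ _
    have h4 := hπ _ _ hg (smoothFun_poissonBracket hsmooth hf hh) Y hY x
    rw [hcomp hf hh hX] at h4
    rw [← h4, h3, poissonBracket]
    exact DFunLike.congr_fun (mvfderiv_neg (I := 𝓘(ℝ, E')) (g := poissonBracket π f h)) _
  have h5 : poissonBracket π h (poissonBracket π f g) (leafProj L x) =
      - mvfderiv 𝓘(ℝ, E) (h ∘ leafProj L) x (mlieBracket 𝓘(ℝ, E) X Y x) := by
    rw [poissonBracket, hskew, mvfderiv_comp_eq_pullbackCovector hh hL.contMDiff_leafProj]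
    have hmem := hL.dirac.mlieBracket_mem (hL.smoothFun_comp hf) (hL.smoothFun_comp hg) hX hY x
    rw [← hcomp hf hg hX, mvfderiv_comp_eq_pullbackCovector hfg hL.contMDiff_leafProj] at hmem
    rw [hL.apply_eq_of_bracket hπ hmem]
    rfl
  rw [h1, h2, h5, mvfderiv_mlieBracket hX.1 hY.1 (hL.smoothFun_comp hh)]
  ring

/-- The reduced Poisson structure in terms of the Dirac structure. -/
theorem IsReducedPoisson.apply_eq {π : BivectorField E' (LeafSpace L)}
    (hL : IsReducibleDirac (E' := E') L) (hπ : IsReducedPoisson L π)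
    {x : M} {ξ : Cotangent E' (leafProj L x)} {X : TangentSpace 𝓘(ℝ, E) x}
    (hX : (X, pullbackCovector E E' (leafProj L) x ξ) ∈ L x) :
    π (leafProj L x) ξ = mfderiv 𝓘(ℝ, E) 𝓘(ℝ, E') (leafProj L) x X :=
  hL.apply_eq_of_bracket hπ.bracket hX

theorem IsReducibleDirac.existsUnique_isReducedPoisson (hL : IsReducibleDirac (E' := E') L) :
    ∃! π : BivectorField E' (LeafSpace L), IsReducedPoisson L π := by
  obtain ⟨π, hπ⟩ := hL.exists_bivectorField
  refine ⟨π, ⟨hL.isPoisson_of_bracket hπ, fun f hf => ⟨hL.smoothFun_comp hf,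
    hL.exists_isHamiltonianField hf⟩, hπ⟩, fun π' hπ' => funext fun q => ?_⟩
  obtain ⟨x, rfl⟩ := leafProj_surjective L q
  ext1 ξ
  obtain ⟨X, hX⟩ := hL.exists_mem_pullback x ξ
  rw [hπ'.apply_eq hL hX, hL.apply_eq_of_bracket hπ hX]

end ReducedPoisson

/-! ### The induced map of leaf spaces -/

section ReducedMap

variable {E : Type*} [NormedAddCommGroup E] [NormedSpace ℝ E]
  {F : Type*} [NormedAddCommGroup F] [NormedSpace ℝ F]
  {M : Type*} [TopologicalSpace M] [ChartedSpace E M]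
  {N : Type*} [TopologicalSpace N] [ChartedSpace F N]
  {L : Π x : M, Submodule ℝ (GenTangent E x)} {K : Π y : N, Submodule ℝ (GenTangent F y)}

/-- Taking the covector `0` in the forward image sends `D_L` into `D_K`; hence `φ` carries curves
tangent to `D_L` to curves tangent to `D_K`. -/
theorem IsForwardDirac.preservesFoliations {φ : M → N} (hφ : IsForwardDirac φ L K) :
    PreservesFoliations φ L K := by
  have hdist : ∀ (x : M), ∀ X ∈ charDist L x,
      mfderiv 𝓘(ℝ, E) 𝓘(ℝ, F) φ x X ∈ charDist K (φ x) := by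
    intro x X hX
    have h : ((mfderiv 𝓘(ℝ, E) 𝓘(ℝ, F) φ x X, 0) : GenTangent F (φ x)) ∈
        (K (φ x) : Set (GenTangent F (φ x))) := by
      rw [hφ.image_eq x]
      refine ⟨X, 0, ?_, rfl⟩
      rw [map_zero]
      exact hX
    exact h
  refine ⟨hdist, fun x y hxy => ?_⟩
  have hgen : Relation.EqvGen (JoinedAlong L) x y := Quotient.exact hxy
  clear hxy
  induction hgen with
  | rel x y hj =>
    obtain ⟨γ, hγ, htan, rfl, rfl⟩ := hj
    refine Quotient.sound (Relation.EqvGen.rel _ _ ⟨φ ∘ γ, hφ.smooth.comp hγ, fun t => ?_, rfl, rfl⟩)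
    exact mem_of_eq_of_mem (mfderiv_comp_apply t (hφ.smooth.mdifferentiableAt (by simp))
      (hγ.mdifferentiableAt (by simp)) (1 : ℝ)) (hdist _ _ (htan t))
  | refl => rfl
  | symm x y _ ih => exact ih.symm
  | trans x y z _ _ ih1 ih2 => exact ih1.trans ih2

/-- The map of leaf spaces induced by a map preserving the characteristic foliations. -/
def PreservesFoliations.reducedMap {φ : M → N} (h : PreservesFoliations φ L K) :
    LeafSpace L → LeafSpace K :=
  Quotient.lift (fun x => leafProj K (φ x)) fun a b hab => h.leaf a b (Quotient.sound hab)

theorem PreservesFoliations.reducedMap_comp {φ : M → N} (h : PreservesFoliations φ L K) :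
    h.reducedMap ∘ leafProj L = leafProj K ∘ φ := rfl

variable {E' : Type*} [NormedAddCommGroup E'] [NormedSpace ℝ E']
  {F' : Type*} [NormedAddCommGroup F'] [NormedSpace ℝ F']
  [IsManifold 𝓘(ℝ, E) ∞ M] [IsManifold 𝓘(ℝ, F) ∞ N]
  [ChartedSpace E' (LeafSpace L)] [IsManifold 𝓘(ℝ, E') ∞ (LeafSpace L)]
  [ChartedSpace F' (LeafSpace K)] [IsManifold 𝓘(ℝ, F') ∞ (LeafSpace K)]

/-- Locally the induced map is `q ∘ φ ∘ σ` for a smooth local section `σ` of `p`. -/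
theorem PreservesFoliations.contMDiff_reducedMap {φ : M → N} (h : PreservesFoliations φ L K)
    (hφ : ContMDiff 𝓘(ℝ, E) 𝓘(ℝ, F) ∞ φ) (hL : IsReducibleDirac (E' := E') L)
    (hK : IsReducibleDirac (E' := F') K) :
    ContMDiff 𝓘(ℝ, E') 𝓘(ℝ, F') ∞ h.reducedMap := by
  intro q
  obtain ⟨x, rfl⟩ := Quotient.mk_surjective q
  obtain ⟨σ, -, hσ⟩ := exists_local_section (hL.submersion.isSubmersionAt x)
  have h1 : ContMDiffAt 𝓘(ℝ, E') 𝓘(ℝ, F') ∞ ((leafProj K ∘ φ) ∘ σ) (leafProj L x) :=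
    ((hK.submersion.contMDiff.comp hφ).contMDiffAt).comp _ hσ.self_of_nhds.1
  refine h1.congr_of_eventuallyEq ?_
  filter_upwards [hσ] with r hr
  rw [← h.reducedMap_comp, Function.comp_apply, Function.comp_apply, hr.2]

variable [FiniteDimensional ℝ E] [FiniteDimensional ℝ F] [FiniteDimensional ℝ E']
  [FiniteDimensional ℝ F'] [T2Space M] [SecondCountableTopology M] [T2Space N]
  [SecondCountableTopology N] [T2Space (LeafSpace L)] [T2Space (LeafSpace K)]

/-- The reduced map relates the reduced Poisson structures. -/
theorem IsForwardDirac.mfderiv_reducedMap_apply {φ : M → N} (hφ : IsForwardDirac φ L K)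
    (hL : IsReducibleDirac (E' := E') L) (hK : IsReducibleDirac (E' := F') K)
    {πM : BivectorField E' (LeafSpace L)} {πN : BivectorField F' (LeafSpace K)}
    (hM : IsReducedPoisson L πM) (hN : IsReducedPoisson K πN) (q : LeafSpace L)
    (ξ : Cotangent F' (hφ.preservesFoliations.reducedMap q)) :
    mfderiv 𝓘(ℝ, E') 𝓘(ℝ, F') hφ.preservesFoliations.reducedMap q
      (πM q (pullbackCovector E' F' hφ.preservesFoliations.reducedMap q ξ)) =
        πN (hφ.preservesFoliations.reducedMap q) ξ := by
  obtain ⟨x, rfl⟩ := leafProj_surjective L q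
  have hsm := hφ.preservesFoliations.contMDiff_reducedMap hφ.smooth hL hK
  obtain ⟨Y, hY⟩ := hK.exists_mem_pullback (φ x) ξ
  have hY' : ((Y, pullbackCovector F F' (leafProj K) (φ x) ξ) : GenTangent F (φ x)) ∈
    (K (φ x) : Set (GenTangent F (φ x))) := hY
  rw [hφ.image_eq x] at hY'
  -- The f-Dirac condition lifts `Y` to `X` with `φ_* X = Y`, paired in `L` with the pullback of
  -- `q^*ξ`.
  obtain ⟨X, α, hX, heq⟩ := hY'
  obtain ⟨rfl, rfl⟩ := Prod.mk.inj heq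
  have hd : (mfderiv 𝓘(ℝ, E') 𝓘(ℝ, F') hφ.preservesFoliations.reducedMap (leafProj L x)).comp
      (mfderiv 𝓘(ℝ, E) 𝓘(ℝ, E') (leafProj L) x) =
      (mfderiv 𝓘(ℝ, F) 𝓘(ℝ, F') (leafProj K) (φ x)).comp (mfderiv 𝓘(ℝ, E) 𝓘(ℝ, F) φ x) :=
    (mfderiv_comp x (hsm.mdifferentiableAt (by simp))
      (hL.contMDiff_leafProj.mdifferentiableAt (by simp))).symm.trans
      (mfderiv_comp x (hK.contMDiff_leafProj.mdifferentiableAt (by simp))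
        (hφ.smooth.mdifferentiableAt (by simp)))
  have hpull : pullbackCovector E F φ x (pullbackCovector F F' (leafProj K) (φ x) ξ) =
      pullbackCovector E E' (leafProj L) x (pullbackCovector E' F' hφ.preservesFoliations.reducedMap (leafProj L x) ξ) :=
    congrArg (fun A : TangentSpace 𝓘(ℝ, E) x →L[ℝ] F' =>
      (show F' →L[ℝ] ℝ from ξ).comp A) hd.symm
  rw [hpull] at hX
  rw [hM.apply_eq hL hX]
  exact (DFunLike.congr_fun hd X).trans (hN.apply_eq hK hY).symm

end ReducedMap

/-! ### Consequences of relatedness of two bivector fields -/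

section PoissonMaps

variable {E : Type*} [NormedAddCommGroup E] [NormedSpace ℝ E] [FiniteDimensional ℝ E]
  {F : Type*} [NormedAddCommGroup F] [NormedSpace ℝ F] [FiniteDimensional ℝ F]
  {M : Type*} [TopologicalSpace M] [ChartedSpace E M] [IsManifold 𝓘(ℝ, E) ∞ M]
  {N : Type*} [TopologicalSpace N] [ChartedSpace F N] [IsManifold 𝓘(ℝ, F) ∞ N]
  {φ : M → N} {πM : BivectorField E M} {πN : BivectorField F N}

theorem smoothFieldOn_bivectorField_apply {π : BivectorField E M} (hπ : IsPoisson π)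
    {α : Π x : M, Cotangent E x} (hα : SmoothFormOn α univ) :
    SmoothFieldOn (fun x => π x (α x)) univ := smoothFieldOn_of_forall fun x _ =>
  ContMDiffAt.clm_bundle_apply (hπ.smooth x) (hα.smoothFormAt Filter.univ_mem)

theorem isPoissonMap_of_related (hφ : ContMDiff 𝓘(ℝ, E) 𝓘(ℝ, F) ∞ φ)
    (h : ∀ (x : M) (ξ : Cotangent F (φ x)),
      mfderiv 𝓘(ℝ, E) 𝓘(ℝ, F) φ x (πM x (pullbackCovector E F φ x ξ)) = πN (φ x) ξ) :
    IsPoissonMap φ πM πN where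
  smooth := hφ
  bracket f g hf hg x := by
    rw [poissonBracket, mvfderiv_comp_eq_pullbackCovector hf hφ,
      mvfderiv_comp_eq_pullbackCovector hg hφ, poissonBracket, ← h]
    rfl

theorem isForwardDirac_graph_of_related (hφ : ContMDiff 𝓘(ℝ, E) 𝓘(ℝ, F) ∞ φ)
    (h : ∀ (x : M) (ξ : Cotangent F (φ x)),
      mfderiv 𝓘(ℝ, E) 𝓘(ℝ, F) φ x (πM x (pullbackCovector E F φ x ξ)) = πN (φ x) ξ) :
    IsForwardDirac φ (graph πM) (graph πN) where
  smooth := hφ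
  image_eq x := by
    ext w
    constructor
    · rintro ⟨ξ, rfl⟩
      exact ⟨_, ξ, ⟨pullbackCovector E F φ x ξ, rfl⟩, Prod.ext (h x ξ).symm rfl⟩
    · rintro ⟨X, ξ, ⟨η, hη⟩, rfl⟩
      obtain ⟨rfl, rfl⟩ := Prod.mk.inj hη
      exact ⟨ξ, Prod.ext (h x ξ).symm rfl⟩

/-- The anchor condition is the relation `h` itself. It also makes the anchor images of `φ^*α` and
`α` `φ`-related, so each term of the bracket commutes with pullback. -/
theorem isCotangentComorphism_of_related (hφ : ContMDiff 𝓘(ℝ, E) 𝓘(ℝ, F) ∞ φ)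
    (hM : IsPoisson πM) (hN : IsPoisson πN)
    (h : ∀ (x : M) (ξ : Cotangent F (φ x)),
      mfderiv 𝓘(ℝ, E) 𝓘(ℝ, F) φ x (πM x (pullbackCovector E F φ x ξ)) = πN (φ x) ξ) :
    IsCotangentComorphism φ πM πN (pullbackCovector E F φ) := by
  have hsmooth : ∀ α : Π y : N, Cotangent F y, SmoothFormOn α univ →
      SmoothFormOn (fun x => pullbackCovector E F φ x (α (φ x))) univ := fun α hα =>
    smoothFormOn_of_forall fun x _ =>
      ContMDiff.smoothFormAt_pullback hφ (hα.smoothFormAt Filter.univ_mem)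
  refine ⟨hφ, hsmooth, fun α β hα hβ x => ?_, fun α _ x => h x _⟩
  have hXα := smoothFieldOn_bivectorField_apply hM (hsmooth α hα)
  have hXβ := smoothFieldOn_bivectorField_apply hM (hsmooth β hβ)
  have hYα := smoothFieldOn_bivectorField_apply hN hα
  have hYβ := smoothFieldOn_bivectorField_apply hN hβ
  have h1 := lieDerivForm_pullback hφ hXα hYα (fun x => h x _) hβ x
  have h2 := lieDerivForm_pullback hφ hXβ hYβ (fun x => h x _) hα x
  have hfun : (fun y => pullbackCovector E F φ y (β (φ y))
      (πM y (pullbackCovector E F φ y (α (φ y))))) =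
      (fun y => β y (πN y (α y))) ∘ φ :=
    funext fun y => congrArg (β (φ y)) (h y _)
  have hsm : SmoothFun F (fun y => β y (πN y (α y))) := fun y =>
    (hβ.smoothFormAt Filter.univ_mem).apply (hYα.smoothFieldAt Filter.univ_mem)
  rw [cotangentBracket, cotangentBracket, h1, h2, hfun,
    mvfderiv_comp_eq_pullbackCovector hsm hφ, map_sub, map_sub]

end PoissonMaps

end DiracGeometry

end

theorem mainTheorem7
    {E : Type*} [NormedAddCommGroup E] [NormedSpace ℝ E] [FiniteDimensional ℝ E]
    {F : Type*} [NormedAddCommGroup F] [NormedSpace ℝ F] [FiniteDimensional ℝ F]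
    {E' : Type*} [NormedAddCommGroup E'] [NormedSpace ℝ E'] [FiniteDimensional ℝ E']
    {F' : Type*} [NormedAddCommGroup F'] [NormedSpace ℝ F'] [FiniteDimensional ℝ F']
    {M : Type*} [TopologicalSpace M] [T2Space M] [SecondCountableTopology M]
    [ChartedSpace E M] [IsManifold 𝓘(ℝ, E) ∞ M]
    {N : Type*} [TopologicalSpace N] [T2Space N] [SecondCountableTopology N]
    [ChartedSpace F N] [IsManifold 𝓘(ℝ, F) ∞ N]
    (L : Π x : M, Submodule ℝ (DiracGeometry.GenTangent E x))
    (K : Π y : N, Submodule ℝ (DiracGeometry.GenTangent F y))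
    [T2Space (DiracGeometry.LeafSpace L)] [ChartedSpace E' (DiracGeometry.LeafSpace L)]
    [IsManifold 𝓘(ℝ, E') ∞ (DiracGeometry.LeafSpace L)]
    [T2Space (DiracGeometry.LeafSpace K)] [ChartedSpace F' (DiracGeometry.LeafSpace K)]
    [IsManifold 𝓘(ℝ, F') ∞ (DiracGeometry.LeafSpace K)]
    (hL : DiracGeometry.IsReducibleDirac (E' := E') L)
    (hK : DiracGeometry.IsReducibleDirac (E' := F') K)
    (φ : M → N) (hφ : DiracGeometry.IsForwardDirac φ L K) :
    DiracGeometry.PreservesFoliations φ L K ∧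
    (∃! πM : DiracGeometry.BivectorField E' (DiracGeometry.LeafSpace L),
      DiracGeometry.IsReducedPoisson L πM) ∧
    (∃! πN : DiracGeometry.BivectorField F' (DiracGeometry.LeafSpace K),
      DiracGeometry.IsReducedPoisson K πN) ∧
    ∃ φbar : DiracGeometry.LeafSpace L → DiracGeometry.LeafSpace K,
      (∀ x : M, φbar (DiracGeometry.leafProj L x) = DiracGeometry.leafProj K (φ x)) ∧
      ∀ (πM : DiracGeometry.BivectorField E' (DiracGeometry.LeafSpace L))
        (πN : DiracGeometry.BivectorField F' (DiracGeometry.LeafSpace K)),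
        DiracGeometry.IsReducedPoisson L πM → DiracGeometry.IsReducedPoisson K πN →
          DiracGeometry.IsPoissonMap φbar πM πN ∧
          DiracGeometry.IsForwardDirac φbar
            (DiracGeometry.graph πM) (DiracGeometry.graph πN) ∧
          DiracGeometry.IsCotangentComorphism φbar πM πN
            (DiracGeometry.pullbackCovector E' F' φbar) := by
  refine ⟨hφ.preservesFoliations, hL.existsUnique_isReducedPoisson,
    hK.existsUnique_isReducedPoisson, hφ.preservesFoliations.reducedMap, fun x => rfl,
    fun πM πN hM hN => ?_⟩
  have hsm := hφ.preservesFoliations.contMDiff_reducedMap hφ.smooth hL hK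
  have h := hφ.mfderiv_reducedMap_apply hL hK hM hN
  exact ⟨DiracGeometry.isPoissonMap_of_related hsm h,
    DiracGeometry.isForwardDirac_graph_of_related hsm h,
    DiracGeometry.isCotangentComorphism_of_related hsm hM.poisson hN.poisson h⟩
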